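/- **Setting.** Let $G=GL^+(2,\mathbb C)$ be the Lie group of complex $2\times2$ matrices with positive real determinant, with unit $I$ and Lie algebra $\mathfrak g=\{X\in M_2(\mathbb C):\operatorname{tr}X\in\mathbb R\}$. Let $$\sigma_0=I,\quad \sigma_1=\begin{pmatrix}0&1\\1&0\end{pmatrix},\quad \sigma_2=\begin{pmatrix}0&i\\-i&0\end{pmatrix},\quad \sigma_3=\begin{pmatrix}1&0\\0&-1\end{pmatrix},$$ $e_k=\sigma_k/2$ for $0\le k\le3$ and $e_{k+3}=ie_k$ for $1\le k\le 3$; this is a basis of $\mathfrak g$. Let $\langle\cdot,\cdot\rangle$ be the pseudoscalar product on $\mathfrak g$ with orthonormal basis $e_0,\dots,e_6$, $\langle e_0,e_0\rangle=1$, $\langle e_k,e_k\rangle=-1$ $(k\ge1)$; let $H$ be the space of Hermitian matrices (spanned by $e_0,\dots,e_3$) and $H_0\subset H$ the subspace of traceless ones, with scalar product $(\cdot,\cdot)=-\langle\cdot,\cdot\rangle$. *Sub-Lorentzian structure on $G$.* A Lipschitz curve $g:[a,b]\to G$, $a<b$, is future directed nonspacelike if, for almost all $t$, $u(t)=g(t)^{-1}g'(t)$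 satisfies $u\in H$, $\langle u,u\rangle\ge0$, $\langle u,e_0\rangle>0$; its length is $L(g)=\int_a^b\sqrt{\langle u,u\rangle}\,dt$. Let $d(x,y)$ be the supremum of the lengths of such curves from $x$ to $y$ ($-\infty$ if there are none). Such a curve $g$ on $[a,b]$ is a longest arc if $L(g)=d(g(a),g(b))$; a curve $g:\mathbb R\to G$ is a geodesic if every $t$ is the midpoint of an interval of positive length over which $g$ is a longest arc. *Sub-Riemannian structure on $SL(2,\mathbb C)$.* A Lipschitz curve $\gamma:[a,b]\to SL(2,\mathbb C)$ is horizontal if $v=\gamma^{-1}\gamma'\in H_0$ almost everywhere; its speed is $\sqrt{(v,v)}$ and its length is the integral of the speed. Let $\rho$ be the infimum of the lengths of horizontal curves with given endpoints. Shortest arcs are horizontal curves whose length equals the distance $\rho$ of their endpoints; a geodesic is a curve on $\mathbb R$ that is, in the same sense, locally a shortest arc. *Normal extremals.* Let $g:\mathbb R\to G$ be locally Lipschitz and $u=g^{-1}g'$, and let $\psi:\mathbb R\to\mathfrak g^*$ be locally absolutely continuous and nowhere zero, with $\psi(w)'=\psi([u,w])$ almost everywhere for each $w\in\mathfrak g$.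 Then $g$ is a *normal timelike extremal* if, for some such $\psi$ and some constant $M_0>0$, for almost all $t$: $u\in H$, $\langle u,u\rangle=1$, $\langle u,e_0\rangle>0$, and $$\psi(t)(u(t))=\min_{U}\psi(t)=M_0,\qquad U=\{x\in H:\langle x,x\rangle\ge1,\ \langle x,e_0\rangle>0\}.$$ It is a *normal isotropic extremal* if, for some such $\psi$ and some constant $M_0>0$ (which may be normalized to $1$), $\psi(t)(e_0)=M_0$ for all $t$ and for almost all $t$: $u\in H$, $\langle u,u\rangle=0$, $\langle u,e_0\rangle=1$, and $$\psi(t)(u(t)-e_0)=\min_{W}\psi(t)=-M_0,\qquad W=\{w\in H:\langle w,e_0\rangle=0,\ \langle w,w\rangle=-1\}.$$ **Theorem.** Let $g:\mathbb R\to G$ be a normal timelike or a normal isotropic extremal with $g(0)=I$. Then: 1. $g$ is a geodesic of $(G,d)$. 2. Either $g(t)=e^{t/2}I$ for all $t$, and then every segment of $g$ is a longest arc; or there are a geodesic $\gamma:\mathbb R\to SL(2,\mathbb C)$ of $(SL(2,\mathbb C),\rho)$ of constant speed $\sigma>0$ and a constant $r>0$ such that $t\mapsto e^{t/2}\gamma(t)$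 is a future directed nonspacelike curve, $g(t)=e^{rt/2}\gamma(rt)$ for all $t\in\mathbb R$, and, for all $a<b$, the segment of $g$ over $[a,b]$ is a longest arc if and only if the segment of $\gamma$ over $[ra,rb]$ is a shortest arc. 3. If $a<b$ and the segment of $g$ over $[a,b]$ is a longest arc, then, with $T=b-a$, the curve $k(t)=g(a)^{-1}g(a+t)$, $0\le t\le T$ (for $a=0$ the segment itself) is of one of the following types: * $k(t)=e^{t/2}I$ for $0\le t\le T$; * there are $\xi\ge\eta>0$, $g_1\in SL(2,\mathbb C)$ with $\rho(I,g_1)=\eta$ and $k(T)=e^{\xi/2}g_1$, and a shortest arc $\gamma:[0,\eta]\to SL(2,\mathbb C)$ from $I$ to $g_1$ parametrized by arclength, such that either $\xi>\eta$ and, for some $c>0$, $\xi=T\cosh c$, $\eta=T\sinh c$ and $k(t)=e^{\cosh(c)t/2}\gamma(\sinh(c)t)$ for $0\le t\le T$; or $\xi=\eta=T$ and $k(t)=e^{t/2}\gamma(t)$ for $0\le t\le T$. -/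

import Mathlib

open MeasureTheory Set
open scoped NNReal

noncomputable section

namespace SubLorentz

/-- Complex `2 × 2` matrices. -/
abbrev Mat : Type := Matrix (Fin 2) (Fin 2) ℂ

attribute [local instance] LieRing.ofAssociativeRing

/-- The Lie group `SL(2,ℂ)`. -/
abbrev SL2C : Type := Matrix.SpecialLinearGroup (Fin 2) ℂ

/-- The Lie group `GL⁺(2,ℂ)` of complex `2 × 2` matrices with positive real determinant. -/
def GLp : Subgroup (GL (Fin 2) ℂ) where
  carrier := {x | 0 < (x : Mat).det.re ∧ (x : Mat).det.im = 0}
  one_mem' := by simp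
  mul_mem' := by
    rintro x y ⟨hx, hx'⟩ ⟨hy, hy'⟩
    simp only [mem_ofPred_eq, Units.val_mul, Matrix.det_mul, Complex.mul_re, Complex.mul_im,
      hx', hy']
    constructor
    · simpa using mul_pos hx hy
    · simp
  inv_mem' := by
    rintro x ⟨hx, hx'⟩
    have h : ((x⁻¹ : GL (Fin 2) ℂ) : Mat).det = ((x : Mat).det)⁻¹ := by
      rw [Matrix.coe_units_inv, Matrix.det_nonsing_inv, Ring.inverse_eq_inv']
    have hn : 0 < Complex.normSq (x : Mat).det := by
      rw [Complex.normSq_pos]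
      intro h0
      rw [h0] at hx
      simp at hx
    simp only [mem_ofPred_eq, h, Complex.inv_re, Complex.inv_im, hx']
    exact ⟨div_pos hx hn, by simp⟩

/-- The matrix of an element of `GL⁺(2,ℂ)`. -/
def mat (x : GLp) : Mat := ((x : GL (Fin 2) ℂ) : Mat)

/-- The Lie algebra `gl⁺(2,ℂ)` of `GL⁺(2,ℂ)`: complex `2 × 2` matrices with real trace, with the
commutator bracket. -/
def gl2p : LieSubalgebra ℝ Mat where
  carrier := {X | X.trace.im = 0}
  zero_mem' := by simp
  add_mem' := by
    intro X Y hX hY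
    simp only [mem_ofPred_eq, Matrix.trace_add, Complex.add_im] at *
    rw [hX, hY, add_zero]
  smul_mem' := by
    intro c X hX
    simp only [mem_ofPred_eq, Matrix.trace_smul, Complex.smul_im] at *
    rw [hX, smul_zero]
  lie_mem' := by
    intro X Y _ _
    simp [Ring.lie_def, Matrix.trace_sub, Matrix.trace_mul_comm X Y]

/-- The basis `e₀, …, e₆` of `gl⁺(2,ℂ)`: halves of the identity and of the Pauli matrices, and
the Pauli halves multiplied by the imaginary unit. -/
def e : Fin 7 → Mat :=
  ![(1 / 2 : ℂ) • !![1, 0; 0, 1],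
    (1 / 2 : ℂ) • !![0, 1; 1, 0],
    (1 / 2 : ℂ) • !![0, Complex.I; -Complex.I, 0],
    (1 / 2 : ℂ) • !![1, 0; 0, -1],
    (Complex.I / 2) • !![0, 1; 1, 0],
    (Complex.I / 2) • !![0, Complex.I; -Complex.I, 0],
    (Complex.I / 2) • !![1, 0; 0, -1]]

/-- The `k`-th coordinate of an element of `gl⁺(2,ℂ)` in the basis `e`, which is orthogonal with
all squared lengths `1/2` for `Re tr (X Yᴴ)`. -/
def coord (k : Fin 7) (X : Mat) : ℝ := 2 * ((X * (e k).conjTranspose).trace).re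

/-- The pseudoscalar product of signature `(+,-,…,-)` on `gl⁺(2,ℂ)` for which `e` is
orthonormal. -/
def lprod (X Y : Mat) : ℝ :=
  coord 0 X * coord 0 Y - ∑ k : Fin 6, coord k.succ X * coord k.succ Y

/-- The scalar product on `sl(2,ℂ)` for which `e₁, …, e₆` is orthonormal. -/
def sprod (X Y : Mat) : ℝ := ∑ k : Fin 6, coord k.succ X * coord k.succ Y

/-- The vector `e₀`, which defines the time orientation, as an element of `gl⁺(2,ℂ)`. -/
def e0 : gl2p := ⟨e 0, by
  change (e 0).trace.im = 0
  simp [e, Matrix.trace_fin_two]⟩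

/-- The curve `c` is Lipschitz on `[a, b]`, entry by entry. -/
def LipschitzOnIcc (c : ℝ → Mat) (a b : ℝ) : Prop :=
  ∃ K : ℝ≥0, ∀ i j, LipschitzOnWith K (fun t => c t i j) (Icc a b)

/-- The velocity `g'(t)` of a matrix curve moved to the unit by the left shift, that is
`g(t)⁻¹ g'(t)`. It is used for Lipschitz curves, which are differentiable almost everywhere. -/
def velocity (c : ℝ → Mat) (t : ℝ) : Mat :=
  (c t)⁻¹ * Matrix.of fun i j => deriv (fun s => c s i j) t

/-! ### The sub-Lorentzian structure on `GL⁺(2,ℂ)` -/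

/-- `u(t) = g(t)⁻¹ g'(t)` for a curve in `GL⁺(2,ℂ)`. -/
def velG (g : ℝ → GLp) (t : ℝ) : Mat := velocity (fun s => mat (g s)) t

/-- `g` restricted to `[a, b]` is a future directed nonspacelike (horizontal Lipschitz) curve.
The horizontal distribution is spanned by the left shifts of the Hermitian matrices. -/
structure IsFutureNonspacelike (g : ℝ → GLp) (a b : ℝ) : Prop where
  lipschitz : LipschitzOnIcc (fun t => mat (g t)) a b
  horizontal : ∀ᵐ t : ℝ, t ∈ Icc a b → (velG g t).IsHermitian
  nonspacelike : ∀ᵐ t : ℝ, t ∈ Icc a b → 0 ≤ lprod (velG g t) (velG g t)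
  future : ∀ᵐ t : ℝ, t ∈ Icc a b → 0 < lprod (velG g t) e0

/-- The sub-Lorentzian length of `g` on `[a, b]`. -/
def lengthG (g : ℝ → GLp) (a b : ℝ) : ℝ := ∫ t in a..b, √(lprod (velG g t) (velG g t))

/-- The sub-Lorentzian (anti)metric: the supremum of the lengths of the future directed
nonspacelike curves from `x` to `y`; it is `-∞` if there are none. -/
def d (x y : GLp) : EReal :=
  sSup {L : EReal | ∃ (g : ℝ → GLp) (a : ℝ), 0 < a ∧ IsFutureNonspacelike g 0 a ∧
    g 0 = x ∧ g a = y ∧ L = (lengthG g 0 a : EReal)}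

/-- The segment of `g` over `[a, b]` is a longest arc. -/
def IsLongestArc (g : ℝ → GLp) (a b : ℝ) : Prop :=
  a < b ∧ IsFutureNonspacelike g a b ∧ (lengthG g a b : EReal) = d (g a) (g b)

/-- `g : ℝ → GL⁺(2,ℂ)` is a sub-Lorentzian geodesic: locally it is a longest arc. -/
def IsLorentzGeodesic (g : ℝ → GLp) : Prop :=
  ∀ t : ℝ, ∃ ε > 0, IsLongestArc g (t - ε) (t + ε)

/-! ### The sub-Riemannian metric on `SL(2,ℂ)` -/

/-- `u(t) = γ(t)⁻¹ γ'(t)` for a curve in `SL(2,ℂ)`. -/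
def velS (γ : ℝ → SL2C) (t : ℝ) : Mat := velocity (fun s => (γ s : Mat)) t

/-- `γ` restricted to `[a, b]` is a Lipschitz horizontal curve; the horizontal distribution is
spanned by the left shifts of the traceless Hermitian matrices. -/
structure IsHorizontal (γ : ℝ → SL2C) (a b : ℝ) : Prop where
  lipschitz : LipschitzOnIcc (fun t => (γ t : Mat)) a b
  horizontal : ∀ᵐ t : ℝ, t ∈ Icc a b → (velS γ t).IsHermitian ∧ (velS γ t).trace = 0

/-- The speed of a curve in `SL(2,ℂ)`. -/
def speed (γ : ℝ → SL2C) (t : ℝ) : ℝ := √(sprod (velS γ t) (velS γ t))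

/-- The sub-Riemannian length of `γ` on `[a, b]`. -/
def lengthS (γ : ℝ → SL2C) (a b : ℝ) : ℝ := ∫ t in a..b, speed γ t

/-- The sub-Riemannian metric: the infimum of the lengths of the horizontal curves from `x` to
`y`. -/
def rho (x y : SL2C) : EReal :=
  sInf {L : EReal | ∃ (γ : ℝ → SL2C) (a : ℝ), 0 < a ∧ IsHorizontal γ 0 a ∧
    γ 0 = x ∧ γ a = y ∧ L = (lengthS γ 0 a : EReal)}

/-- The segment of `γ` over `[a, b]` is a shortest arc. -/
def IsShortestArc (γ : ℝ → SL2C) (a b : ℝ) : Prop :=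
  a < b ∧ IsHorizontal γ a b ∧ (lengthS γ a b : EReal) = rho (γ a) (γ b)

/-- `γ : ℝ → SL(2,ℂ)` is a sub-Riemannian geodesic: locally it is a shortest arc. -/
def IsRiemGeodesic (γ : ℝ → SL2C) : Prop :=
  ∀ t : ℝ, ∃ ε > 0, IsShortestArc γ (t - ε) (t + ε)

/-! ### Normal extremals -/

/-- The control region of the timelike problem. -/
def U : Set gl2p :=
  {u | (u : Mat).IsHermitian ∧ 1 ≤ lprod (u : Mat) (u : Mat) ∧ 0 < lprod (u : Mat) e0}

/-- The control region of the isotropic problem. -/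
def W : Set gl2p :=
  {w | (w : Mat).IsHermitian ∧ lprod (w : Mat) e0 = 0 ∧ lprod (w : Mat) (w : Mat) = -1}

/-- `g` is a (locally Lipschitz) trajectory of `g' = g u`, and `ψ` is a nowhere vanishing
absolutely continuous covector function that satisfies the conjugate equation
`ψ(w)' = ψ([u, w])`. -/
structure IsConjugatePair (g : ℝ → GLp) (u : ℝ → gl2p) (ψ : ℝ → Module.Dual ℝ gl2p) : Prop where
  lipschitz : ∀ a b, LipschitzOnIcc (fun t => mat (g t)) a b
  trajectory : ∀ᵐ t : ℝ, velG g t = (u t : Mat)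
  ne_zero : ∀ t, ψ t ≠ 0
  absCont : ∀ w a b, AbsolutelyContinuousOnInterval (fun t => ψ t w) a b
  conjugate : ∀ w, ∀ᵐ t : ℝ, HasDerivAt (fun s => ψ s w) (ψ t ⁅u t, w⁆) t

/-- Normal timelike extremals: future directed timelike curves, parametrized by arclength, that
satisfy the minimum principle over `U` with a positive minimum. -/
def IsNormalTimelikeExtremal (g : ℝ → GLp) : Prop :=
  ∃ (u : ℝ → gl2p) (ψ : ℝ → Module.Dual ℝ gl2p) (M₀ : ℝ), IsConjugatePair g u ψ ∧ 0 < M₀ ∧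
    ∀ᵐ t : ℝ, (u t : Mat).IsHermitian ∧ lprod (u t : Mat) (u t : Mat) = 1 ∧
      0 < lprod (u t : Mat) e0 ∧ ψ t (u t) = M₀ ∧ IsLeast (ψ t '' U) M₀

/-- Normal isotropic extremals, normalized by `u₀ = 1`: future directed isotropic curves for
which `w = u - e₀` minimizes `ψ` over `W`, the minimum being `-ψ(e₀) < 0`. (The covector function
may be multiplied by a positive constant, so that `ψ(e₀) = 1`.) -/
def IsNormalIsotropicExtremal (g : ℝ → GLp) : Prop :=
  ∃ (u : ℝ → gl2p) (ψ : ℝ → Module.Dual ℝ gl2p) (M₀ : ℝ), IsConjugatePair g u ψ ∧ 0 < M₀ ∧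
    (∀ t, ψ t e0 = M₀) ∧
    ∀ᵐ t : ℝ, (u t : Mat).IsHermitian ∧ lprod (u t : Mat) (u t : Mat) = 0 ∧
      lprod (u t : Mat) e0 = 1 ∧ ψ t (u t - e0) = -M₀ ∧ IsLeast (ψ t '' W) (-M₀)

/-! ### The explicit curves -/

/-- The element `e^{s/2} x` of `GL⁺(2,ℂ)`, for real `s` and `x` in `SL(2,ℂ)`. -/
def expLift (s : ℝ) (x : SL2C) : GLp :=
  have hdet : (((Real.exp (s / 2) : ℝ) : ℂ) • (x : Mat)).det
      = ((Real.exp (s / 2) ^ 2 : ℝ) : ℂ) := by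
    rw [Matrix.det_smul, x.det_coe]
    simp
  ⟨Matrix.GeneralLinearGroup.mkOfDetNeZero (((Real.exp (s / 2) : ℝ) : ℂ) • (x : Mat)) (by
      rw [hdet]
      exact_mod_cast (pow_pos (Real.exp_pos _) 2).ne'),
    by
      change 0 < (((Real.exp (s / 2) : ℝ) : ℂ) • (x : Mat)).det.re ∧
        (((Real.exp (s / 2) : ℝ) : ℂ) • (x : Mat)).det.im = 0
      rw [hdet, Complex.ofReal_re, Complex.ofReal_im]
      exact ⟨pow_pos (Real.exp_pos _) 2, rfl⟩⟩

/-- `k(t)`, `0 ≤ t ≤ T`, is one of the arcs from the unit to `e^{ξ/2} g₁`, `ξ ≥ η = ρ(1, g₁) > 0`,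
built from a shortest arc `γ` from `1` to `g₁` parametrized by arclength: a timelike arc if
`ξ > η`, an isotropic one if `ξ = η`. -/
def IsShortestArcLift (k : ℝ → GLp) (T : ℝ) : Prop :=
  ∃ (ξ η : ℝ) (g₁ : SL2C) (γ : ℝ → SL2C), 0 < η ∧ η ≤ ξ ∧ rho 1 g₁ = (η : EReal) ∧
    k T = expLift ξ g₁ ∧
    IsShortestArc γ 0 η ∧ (∀ᵐ t : ℝ, t ∈ Icc 0 η → speed γ t = 1) ∧ γ 0 = 1 ∧ γ η = g₁ ∧
    ((η < ξ ∧ ∃ c : ℝ, 0 < c ∧ ξ = T * Real.cosh c ∧ η = T * Real.sinh c ∧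
        ∀ t ∈ Icc 0 T, k t = expLift (Real.cosh c * t) (γ (Real.sinh c * t))) ∨
      (ξ = η ∧ T = ξ ∧ ∀ t ∈ Icc 0 T, k t = expLift t (γ t)))

end SubLorentz

end

open SubLorentz

/-!
The map `(s, x) ↦ e^{s/2} x` identifies `GL⁺(2,ℂ)` with the product of `ℝ` and `SL(2,ℂ)`. Under it
the velocity of a curve is `s' e₀ + v`, with `v` the velocity in `SL(2,ℂ)`, and its squared
Lorentzian length is `s'² - |v|²` (`velG_eq_add`, `lprod_add_self`). Longest arcs therefore reduce
to shortest arcs in `SL(2,ℂ)`: the reverse Cauchy–Schwarz inequality bounds the length of a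
nonspacelike curve by the growth of `s` and the length of the unimodular part
(`lengthG_le_of_unit`, `lengthG_nonpos`), and a shorter horizontal curve can be lifted to a longer
nonspacelike one (`exists_lift_lengthG_gt`). For a lift of constant rate of a curve of constant
speed this gives the equivalence `isLongestArc_expLift_iff`.

The minimum principle, timelike or isotropic, says that on Hermitian matrices the covector
function is a multiple of the product with the control `u` (`exists_control_data`). As `e₀` is
central, its value at `e₀` is constant, hence `u = r e₀ + v` with constant `r` and constant `|v| =
q`, where `r² - q² = 1` or `r = q = 1`. The conjugate equation is solved by coadjoint transport
(`dual_transport`), so that the unimodular part is a smooth curve of constant speed whose velocity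
is represented by a covector that is constant in the right trivialization (`exists_smooth_data`).

It remains to see that such a curve `γ` is locally shortest (`IsUnitNormal.isRiemGeodesic`). A
competitor `h` with the same end points and `γ`, run at the speed of `h`, differ by a loop in
`SL(2,ℂ)`. The first variation of the length is the integral of the covector over the velocity of
this loop. For a closed loop that integral is at most quadratic in the `L¹` norm of the velocity
(`abs_integral_le_of_loop`), and over a short segment it is dominated by the strictly convex part
of the energy (`IsUnitNormal.le_lengthS`).
-/

noncomputable section

namespace SubLorentz

open scoped Matrix.Norms.Frobenius
attribute [local instance] LieRing.ofAssociativeRing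
set_option linter.unusedSectionVars false

/-! ### Lipschitz and essentially bounded functions on a segment -/

section Analysis

variable {E F G : Type*} [NormedAddCommGroup E] [NormedSpace ℝ E] [NormedAddCommGroup F]
  [NormedSpace ℝ F] [NormedAddCommGroup G] [NormedSpace ℝ G]

/-- `f` is Lipschitz on `[a, b]`, with an unspecified constant. -/
def LipOn (f : ℝ → E) (a b : ℝ) : Prop := ∃ K : ℝ≥0, LipschitzOnWith K f (Icc a b)

/-- `f` is measurable and essentially bounded on `[a, b]`. -/
def EssBdd (f : ℝ → E) (a b : ℝ) : Prop :=
  AEStronglyMeasurable f (volume.restrict (Icc a b)) ∧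
    ∃ C : ℝ, ∀ᵐ t : ℝ, t ∈ Icc a b → ‖f t‖ ≤ C

lemma ae_mem_Ioo_of_mem_Icc (a b : ℝ) : ∀ᵐ t : ℝ, t ∈ Icc a b → t ∈ Ioo a b := by
  have h₁ : ∀ᵐ x : ℝ, x ≠ a := by simp [ae_iff, measure_singleton]
  have h₂ : ∀ᵐ x : ℝ, x ≠ b := by simp [ae_iff, measure_singleton]
  filter_upwards [h₁, h₂] with x hx hx' hm
  exact ⟨lt_of_le_of_ne hm.1 (Ne.symm hx), lt_of_le_of_ne hm.2 hx'⟩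

namespace LipOn

variable {f : ℝ → E} {a b : ℝ}

lemma continuousOn (hf : LipOn f a b) : ContinuousOn f (Icc a b) := by
  obtain ⟨K, hK⟩ := hf
  exact hK.continuousOn

lemma bounded (hf : LipOn f a b) : ∃ C, 0 ≤ C ∧ ∀ t ∈ Icc a b, ‖f t‖ ≤ C := by
  obtain ⟨C, hC⟩ := isCompact_Icc.exists_bound_of_continuousOn hf.continuousOn
  exact ⟨max C 0, le_max_right _ _, fun t ht => (hC t ht).trans (le_max_left _ _)⟩

lemma of_bound {C : ℝ} (h : ∀ x ∈ Icc a b, ∀ y ∈ Icc a b, ‖f x - f y‖ ≤ C * |x - y|) :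
    LipOn f a b := by
  refine ⟨Real.toNNReal C, LipschitzOnWith.of_dist_le_mul fun x hx y hy => ?_⟩
  rw [dist_eq_norm, Real.dist_eq]
  exact (h x hx y hy).trans
    (mul_le_mul_of_nonneg_right (Real.le_coe_toNNReal C) (abs_nonneg _))

lemma bound (hf : LipOn f a b) :
    ∃ C, 0 ≤ C ∧ ∀ x ∈ Icc a b, ∀ y ∈ Icc a b, ‖f x - f y‖ ≤ C * |x - y| := by
  obtain ⟨K, hK⟩ := hf
  refine ⟨K, K.2, fun x hx y hy => ?_⟩
  rw [← dist_eq_norm, ← Real.dist_eq]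
  exact hK.dist_le_mul x hx y hy

lemma congr {g : ℝ → E} (hf : LipOn f a b) (h : ∀ t ∈ Icc a b, g t = f t) : LipOn g a b := by
  obtain ⟨C, -, hC⟩ := hf.bound
  refine of_bound (C := C) fun x hx y hy => ?_
  rw [h x hx, h y hy]
  exact hC x hx y hy

lemma clm_comp (L : E →L[ℝ] F) (hf : LipOn f a b) : LipOn (fun t => L (f t)) a b := by
  obtain ⟨C, hC0, hC⟩ := hf.bound
  refine of_bound (C := ‖L‖ * C) fun x hx y hy => ?_
  rw [← map_sub, mul_assoc]
  exact (L.le_opNorm _).trans (mul_le_mul_of_nonneg_left (hC x hx y hy) (norm_nonneg _))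

lemma add {g : ℝ → E} (hf : LipOn f a b) (hg : LipOn g a b) :
    LipOn (fun t => f t + g t) a b := by
  obtain ⟨C, -, hC⟩ := hf.bound
  obtain ⟨D, -, hD⟩ := hg.bound
  refine of_bound (C := C + D) fun x hx y hy => ?_
  rw [add_sub_add_comm, add_mul]
  exact (norm_add_le _ _).trans (add_le_add (hC x hx y hy) (hD x hx y hy))

lemma bilin (B : E →L[ℝ] F →L[ℝ] G) {g : ℝ → F} (hf : LipOn f a b) (hg : LipOn g a b) :
    LipOn (fun t => B (f t) (g t)) a b := by
  obtain ⟨C, hC0, hC⟩ := hf.bound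
  obtain ⟨D, hD0, hD⟩ := hg.bound
  obtain ⟨Mf, hMf0, hMf⟩ := hf.bounded
  obtain ⟨Mg, hMg0, hMg⟩ := hg.bounded
  refine of_bound (C := ‖B‖ * Mf * D + ‖B‖ * C * Mg) fun x hx y hy => ?_
  have e1 : B (f x) (g x) - B (f y) (g y) = B (f x) (g x - g y) + B (f x - f y) (g y) := by
    simp
  rw [e1]
  have h1 : ‖B (f x) (g x - g y)‖ ≤ ‖B‖ * Mf * (D * |x - y|) := by
    refine (B.le_opNorm₂ _ _).trans ?_
    gcongr
    · exact hMf x hx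
    · exact hD x hx y hy
  have h2 : ‖B (f x - f y) (g y)‖ ≤ ‖B‖ * (C * |x - y|) * Mg := by
    refine (B.le_opNorm₂ _ _).trans ?_
    gcongr
    · exact hC x hx y hy
    · exact hMg y hy
  refine (norm_add_le _ _).trans ((add_le_add h1 h2).trans (le_of_eq (by ring)))

lemma smul {c : ℝ → ℝ} (hc : LipOn c a b) (hf : LipOn f a b) :
    LipOn (fun t => c t • f t) a b := by
  simpa using bilin (ContinuousLinearMap.lsmul ℝ ℝ) hc hf

lemma mul {A : Type*} [NormedRing A] [NormedAlgebra ℝ A] {f g : ℝ → A} (hf : LipOn f a b)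
    (hg : LipOn g a b) : LipOn (fun t => f t * g t) a b := by
  simpa using bilin (ContinuousLinearMap.mul ℝ A) hf hg

lemma comp_lipschitz {g : ℝ → ℝ} {c d : ℝ} (hf : LipOn f c d) (hg : LipOn g a b)
    (hm : MapsTo g (Icc a b) (Icc c d)) : LipOn (fun t => f (g t)) a b := by
  obtain ⟨K, hK⟩ := hf
  obtain ⟨K', hK'⟩ := hg
  exact ⟨K * K', hK.comp hK' hm⟩

lemma of_hasDerivAt {f' : ℝ → E} (h : ∀ t ∈ Icc a b, HasDerivAt f (f' t) t)
    (hc : ContinuousOn f' (Icc a b)) : LipOn f a b := by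
  obtain ⟨C, hC⟩ := isCompact_Icc.exists_bound_of_continuousOn hc
  refine of_bound (C := C) fun x hx y hy => ?_
  rw [← Real.norm_eq_abs]
  exact (convex_Icc a b).norm_image_sub_le_of_norm_hasDerivWithin_le
    (fun t ht => (h t ht).hasDerivWithinAt) hC hy hx

lemma mono {c d : ℝ} (hf : LipOn f a b) (h : Icc c d ⊆ Icc a b) : LipOn f c d := by
  obtain ⟨K, hK⟩ := hf
  exact ⟨K, hK.mono h⟩

lemma absCont (hf : LipOn f a b) (hab : a ≤ b) : AbsolutelyContinuousOnInterval f a b := by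
  obtain ⟨K, hK⟩ := hf
  rw [← uIcc_of_le hab] at hK
  exact hK.absolutelyContinuousOnInterval

lemma ae_hasDerivAt [FiniteDimensional ℝ E] (hf : LipOn f a b) :
    ∀ᵐ t : ℝ, t ∈ Icc a b → HasDerivAt f (deriv f t) t := by
  obtain ⟨K, hK⟩ := hf
  filter_upwards [hK.ae_differentiableWithinAt_of_mem_real, ae_mem_Ioo_of_mem_Icc a b]
    with t ht ht' hm
  exact ((ht hm).differentiableAt (Icc_mem_nhds (ht' hm).1 (ht' hm).2)).hasDerivAt

end LipOn

namespace EssBdd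

variable {f : ℝ → E} {a b : ℝ}

lemma intervalIntegrable (hf : EssBdd f a b) (hab : a ≤ b) :
    IntervalIntegrable f volume a b := by
  obtain ⟨hm, C, hC⟩ := hf
  rw [intervalIntegrable_iff_integrableOn_Icc_of_le hab]
  refine ⟨hm, HasFiniteIntegral.restrict_of_bounded C (by simp) ?_⟩
  rw [ae_restrict_iff' measurableSet_Icc]
  exact hC

lemma _root_.SubLorentz.LipOn.essBdd (hf : LipOn f a b) : EssBdd f a b := by
  obtain ⟨C, -, hC⟩ := hf.bounded
  exact ⟨hf.continuousOn.aestronglyMeasurable measurableSet_Icc,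
    C, Filter.Eventually.of_forall fun t ht => hC t ht⟩

lemma _root_.SubLorentz.LipOn.essBdd_deriv [FiniteDimensional ℝ E] (hf : LipOn f a b) :
    EssBdd (deriv f) a b := by
  have := FiniteDimensional.complete ℝ E
  obtain ⟨K, hK⟩ := hf
  refine ⟨aestronglyMeasurable_deriv f _, K, ?_⟩
  filter_upwards [ae_mem_Ioo_of_mem_Icc a b] with t ht hm
  exact norm_deriv_le_of_lipschitzOn (Icc_mem_nhds (ht hm).1 (ht hm).2) hK

lemma of_continuousOn (h : ContinuousOn f (Icc a b)) : EssBdd f a b := by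
  obtain ⟨C, hC⟩ := isCompact_Icc.exists_bound_of_continuousOn h
  exact ⟨h.aestronglyMeasurable measurableSet_Icc, C, Filter.Eventually.of_forall hC⟩

lemma const (c : E) : EssBdd (fun _ => c) a b :=
  ⟨aestronglyMeasurable_const, ‖c‖, Filter.Eventually.of_forall fun _ _ => le_rfl⟩

lemma prodMk {g : ℝ → F} (hf : EssBdd f a b) (hg : EssBdd g a b) :
    EssBdd (fun t => (f t, g t)) a b := by
  obtain ⟨hm, C, hC⟩ := hf
  obtain ⟨hm', D, hD⟩ := hg
  refine ⟨hm.prodMk hm', max C D, ?_⟩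
  filter_upwards [hC, hD] with t h h' ht
  exact norm_prod_le_iff.2 ⟨(h ht).trans (le_max_left _ _), (h' ht).trans (le_max_right _ _)⟩

lemma comp [ProperSpace E] {φ : E → F} (hφ : Continuous φ) (hf : EssBdd f a b) :
    EssBdd (fun t => φ (f t)) a b := by
  obtain ⟨hm, C, hC⟩ := hf
  obtain ⟨D, hD⟩ := (isCompact_closedBall (0 : E) C).exists_bound_of_continuousOn
    hφ.continuousOn
  refine ⟨hφ.comp_aestronglyMeasurable hm, D, ?_⟩
  filter_upwards [hC] with t h ht
  exact hD _ (by simpa using h ht)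

lemma comp₂ [ProperSpace E] [ProperSpace F] {φ : E × F → G} (hφ : Continuous φ) {g : ℝ → F}
    (hf : EssBdd f a b) (hg : EssBdd g a b) : EssBdd (fun t => φ (f t, g t)) a b :=
  (hf.prodMk hg).comp hφ

lemma congr {g : ℝ → E} (hf : EssBdd f a b) (h : ∀ᵐ t : ℝ, t ∈ Icc a b → g t = f t) :
    EssBdd g a b := by
  obtain ⟨hm, C, hC⟩ := hf
  refine ⟨hm.congr ?_, C, ?_⟩
  · rw [Filter.EventuallyEq, ae_restrict_iff' measurableSet_Icc]
    filter_upwards [h] with t ht hm using (ht hm).symm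
  · filter_upwards [h, hC] with t ht hC hm
    rw [ht hm]
    exact hC hm

/-- An indefinite integral of an essentially bounded function is Lipschitz. -/
lemma lipOn_integral (hf : EssBdd f a b) (hab : a ≤ b) :
    LipOn (fun x => ∫ t in a..x, f t) a b := by
  have hi := hf.intervalIntegrable hab
  obtain ⟨-, C, hC⟩ := hf
  refine LipOn.of_bound (C := C) fun x hx y hy => ?_
  have hax : IntervalIntegrable f volume a x := hi.mono_set (by
    rw [uIcc_of_le hab, uIcc_of_le hx.1]; exact Icc_subset_Icc_right hx.2)
  have hay : IntervalIntegrable f volume a y := hi.mono_set (by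
    rw [uIcc_of_le hab, uIcc_of_le hy.1]; exact Icc_subset_Icc_right hy.2)
  rw [intervalIntegral.integral_interval_sub_left hax hay]
  refine intervalIntegral.norm_integral_le_of_norm_le_const_ae ?_
  filter_upwards [hC] with t ht hm
  refine ht ?_
  have := uIoc_subset_uIcc hm
  exact (uIcc_subset_Icc hy hx) this

lemma ae_hasDerivAt_integral [CompleteSpace E] (hf : EssBdd f a b) (hab : a ≤ b) :
    ∀ᵐ t : ℝ, t ∈ Icc a b → HasDerivAt (fun x => ∫ t in a..x, f t) (f t) t := by
  filter_upwards [(hf.intervalIntegrable hab).ae_hasDerivAt_integral] with t ht hm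
  rw [uIcc_of_le hab] at ht
  exact ht hm a (left_mem_Icc.2 hab)

end EssBdd

/-- The fundamental theorem of calculus for Lipschitz curves in a Banach space. -/
lemma LipOn.integral_eq_sub [CompleteSpace E] {f f' : ℝ → E} {a b : ℝ} (hf : LipOn f a b)
    (hab : a ≤ b) (hf' : EssBdd f' a b)
    (hd : ∀ᵐ t : ℝ, t ∈ Icc a b → HasDerivAt f (f' t) t) : ∫ t in a..b, f' t = f b - f a := by
  have hac := (hf.absCont hab).sub ((hf'.lipOn_integral hab).absCont hab)
  obtain ⟨C, hC⟩ := hac.const_of_ae_hasDerivAt_zero (by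
    filter_upwards [hd, hf'.ae_hasDerivAt_integral hab] with t h1 h2 hm
    rw [uIcc_of_le hab] at hm
    simpa using (h1 hm).sub (h2 hm))
  have h1 := hC a left_mem_uIcc
  have h2 := hC b right_mem_uIcc
  simp only [Pi.sub_apply, intervalIntegral.integral_same, sub_zero] at h1 h2
  rw [h1, ← h2]
  abel

lemma intervalIntegral_mono_ae {f g : ℝ → ℝ} {a b : ℝ} (hab : a ≤ b) (hf : EssBdd f a b)
    (hg : EssBdd g a b) (h : ∀ᵐ t : ℝ, t ∈ Icc a b → f t ≤ g t) :
    ∫ t in a..b, f t ≤ ∫ t in a..b, g t := by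
  refine intervalIntegral.integral_mono_ae_restrict hab (hf.intervalIntegrable hab)
    (hg.intervalIntegrable hab) ?_
  rw [Filter.EventuallyLE, ae_restrict_iff' measurableSet_Icc]
  exact h

lemma intervalIntegral_congr_ae' {f g : ℝ → E} {a b : ℝ} (hab : a ≤ b)
    (h : ∀ᵐ t : ℝ, t ∈ Icc a b → f t = g t) :
    ∫ t in a..b, f t = ∫ t in a..b, g t := by
  refine intervalIntegral.integral_congr_ae ?_
  filter_upwards [h] with t ht hm
  rw [uIoc_of_le hab] at hm
  exact ht (Ioc_subset_Icc_self hm)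

/-- If a curve that solves `j' = - z j` is closed, from `1` to `1`, the integral of `z` is of second
order in the `L¹` norm of `z`: replacing `z` by `z j` changes the integral to zero, and `j` remains
near `1`. The unit need not have norm one, as in the Frobenius norm of matrices. -/
lemma abs_integral_le_of_loop {A : Type*} [NormedRing A] [NormedAlgebra ℝ A]
    [FiniteDimensional ℝ A] {j z : ℝ → A} {ζ : ℝ → ℝ} {a : ℝ} (ha : 0 ≤ a) (hj : LipOn j 0 a)
    (hz : EssBdd z 0 a) (hζ : EssBdd ζ 0 a)
    (hd : ∀ᵐ t : ℝ, t ∈ Icc 0 a → HasDerivAt j (-(z t * j t)) t)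
    (hzζ : ∀ᵐ t : ℝ, t ∈ Icc 0 a → ‖z t‖ ≤ ζ t) (h0 : j 0 = 1) (h1 : j a = 1)
    (h1n : ‖(1 : A)‖ ≤ 2) (hsmall : ∫ t in 0..a, ζ t ≤ 1 / 2) (lam : A →ₗ[ℝ] ℝ)
    {Λ : ℝ} (hΛ0 : 0 ≤ Λ) (hΛ : ∀ x, |lam x| ≤ Λ * ‖x‖) :
    |∫ t in 0..a, lam (z t)| ≤ 4 * Λ * (∫ t in 0..a, ζ t) ^ 2 := by
  have := FiniteDimensional.complete ℝ A
  have := FiniteDimensional.proper ℝ A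
  set I := ∫ t in 0..a, ζ t with hI
  have hI0 : 0 ≤ I := by
    have := intervalIntegral_mono_ae ha (EssBdd.const (0 : ℝ)) hζ (by
      filter_upwards [hzζ] with t ht hm using (norm_nonneg _).trans (ht hm))
    simpa using this
  have hzj : EssBdd (fun t => z t * j t) 0 a :=
    EssBdd.comp₂ (φ := fun p : A × A => p.1 * p.2) (by fun_prop) hz hj.essBdd
  have hdj : EssBdd (fun t => -(z t * j t)) 0 a := hzj.comp (φ := fun x => -x) (by fun_prop)
  have hz1j : EssBdd (fun t => z t * (1 - j t)) 0 a :=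
    EssBdd.comp₂ (φ := fun p : A × A => p.1 * (1 - p.2)) (by fun_prop) hz hj.essBdd
  -- the distance of `j` from `1`
  have hcont : ContinuousOn (fun t => ‖j t - 1‖) (Icc 0 a) :=
    (hj.continuousOn.sub continuousOn_const).norm
  obtain ⟨tm, htm, hmax⟩ := isCompact_Icc.exists_isMaxOn (nonempty_Icc.2 ha) hcont
  set M := ‖j tm - 1‖ with hM
  have hMle : ∀ t ∈ Icc 0 a, ‖j t - 1‖ ≤ M := fun t ht => hmax ht
  -- a bootstrap in place of Gronwall's inequality
  have hM1 : M ≤ (2 + M) * I := by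
    have hsub : Icc 0 tm ⊆ Icc 0 a := Icc_subset_Icc_right htm.2
    have hdj' : EssBdd (fun t => -(z t * j t)) 0 tm :=
      ⟨hdj.1.mono_measure (Measure.restrict_mono hsub le_rfl), by
        obtain ⟨C, hC⟩ := hdj.2
        exact ⟨C, by filter_upwards [hC] with t ht hm using ht (hsub hm)⟩⟩
    have e1 : j tm - 1 = ∫ t in 0..tm, -(z t * j t) := by
      rw [LipOn.integral_eq_sub (hj.mono hsub) htm.1 hdj'
        (by filter_upwards [hd] with t ht hm using ht (hsub hm)), h0]
    have hbd : ∀ᵐ t : ℝ, t ∈ Icc 0 a → ‖-(z t * j t)‖ ≤ (2 + M) * ζ t := by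
      filter_upwards [hzζ] with t ht hm
      rw [norm_neg, mul_comm (2 + M)]
      refine (norm_mul_le _ _).trans (mul_le_mul (ht hm) ?_ (norm_nonneg _)
        ((norm_nonneg _).trans (ht hm)))
      calc ‖j t‖ = ‖1 + (j t - 1)‖ := by congr 1; abel
        _ ≤ ‖(1 : A)‖ + ‖j t - 1‖ := norm_add_le _ _
        _ ≤ 2 + M := add_le_add h1n (hMle t hm)
    have hζM : EssBdd (fun t => (2 + M) * ζ t) 0 a :=
      hζ.comp (φ := fun x => (2 + M) * x) (by fun_prop)
    have hnd : EssBdd (fun t => ‖-(z t * j t)‖) 0 a := hdj.comp continuous_norm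
    calc M = ‖∫ t in 0..tm, -(z t * j t)‖ := by rw [hM, e1]
      _ ≤ ∫ t in 0..tm, ‖-(z t * j t)‖ :=
          intervalIntegral.norm_integral_le_integral_norm htm.1
      _ ≤ ∫ t in 0..a, ‖-(z t * j t)‖ :=
          intervalIntegral.integral_mono_interval le_rfl htm.1 htm.2
            (Filter.Eventually.of_forall fun t => norm_nonneg _) (hnd.intervalIntegrable ha)
      _ ≤ ∫ t in 0..a, (2 + M) * ζ t := intervalIntegral_mono_ae ha hnd hζM hbd
      _ = (2 + M) * I := intervalIntegral.integral_const_mul _ _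
  have hM0 : 0 ≤ M := norm_nonneg _
  have hM2 : M ≤ 4 * I := by nlinarith
  have hint : ∫ t in 0..a, lam (z t) = ∫ t in 0..a, lam (z t * (1 - j t)) := by
    have hsum : ∫ t in 0..a, lam (z t * j t) = 0 := by
      have hFTC := LipOn.integral_eq_sub hj ha hdj hd
      rw [h0, h1, sub_self, intervalIntegral.integral_neg, neg_eq_zero] at hFTC
      have h3 := ContinuousLinearMap.intervalIntegral_comp_comm lam.toContinuousLinearMap
        (hzj.intervalIntegrable ha)
      rw [hFTC, map_zero] at h3
      exact h3
    have h2 : (fun t => lam (z t)) = fun t => lam (z t * (1 - j t)) + lam (z t * j t) := by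
      funext t
      rw [← map_add, ← mul_add]
      simp
    rw [h2, intervalIntegral.integral_add, hsum, add_zero]
    · exact (hz1j.comp lam.continuous_of_finiteDimensional).intervalIntegrable ha
    · exact (hzj.comp lam.continuous_of_finiteDimensional).intervalIntegrable ha
  rw [hint, ← Real.norm_eq_abs]
  have hb := hz1j.comp lam.continuous_of_finiteDimensional
  calc ‖∫ t in 0..a, lam (z t * (1 - j t))‖ ≤ ∫ t in 0..a, ‖lam (z t * (1 - j t))‖ :=
        intervalIntegral.norm_integral_le_integral_norm ha
    _ ≤ ∫ t in 0..a, (Λ * M) * ζ t := by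
        refine intervalIntegral_mono_ae ha (hb.comp continuous_norm)
          (hζ.comp (φ := fun x => (Λ * M) * x) (by fun_prop)) ?_
        filter_upwards [hzζ] with t ht hm
        have h3 : ‖z t * (1 - j t)‖ ≤ ζ t * M := by
          refine (norm_mul_le _ _).trans (mul_le_mul (ht hm) ?_ (norm_nonneg _)
            ((norm_nonneg _).trans (ht hm)))
          rw [norm_sub_rev]
          exact hMle t hm
        calc ‖lam (z t * (1 - j t))‖ ≤ Λ * ‖z t * (1 - j t)‖ := hΛ _
          _ ≤ Λ * (ζ t * M) := by gcongr
          _ = _ := by ring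
    _ = (Λ * M) * I := intervalIntegral.integral_const_mul _ _
    _ ≤ (Λ * (4 * I)) * I := by gcongr
    _ = _ := by ring

end Analysis

/-! ### Coordinates -/

lemma coord_zero (X : Mat) : coord 0 X = X.trace.re := by
  simp [coord, e, Matrix.trace_fin_two, Matrix.mul_apply, Matrix.conjTranspose_apply]
  ring

lemma coord_one (X : Mat) : coord 1 X = (X 0 1).re + (X 1 0).re := by
  simp [coord, e, Matrix.trace_fin_two, Matrix.mul_apply, Matrix.conjTranspose_apply]
  ring

lemma coord_two (X : Mat) : coord 2 X = (X 0 1).im - (X 1 0).im := by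
  simp [coord, e, Matrix.trace_fin_two, Matrix.mul_apply, Matrix.conjTranspose_apply]
  ring

lemma coord_three (X : Mat) : coord 3 X = (X 0 0).re - (X 1 1).re := by
  simp [coord, e, Matrix.trace_fin_two, Matrix.mul_apply, Matrix.conjTranspose_apply]
  ring

lemma coord_four (X : Mat) : coord 4 X = (X 0 1).im + (X 1 0).im := by
  simp [coord, e, Matrix.trace_fin_two, Matrix.mul_apply, Matrix.conjTranspose_apply, map_ofNat]
  ring

lemma coord_five (X : Mat) : coord 5 X = (X 1 0).re - (X 0 1).re := by
  simp [coord, e, Matrix.trace_fin_two, Matrix.mul_apply, Matrix.conjTranspose_apply, map_ofNat]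
  ring

lemma coord_six (X : Mat) : coord 6 X = (X 0 0).im - (X 1 1).im := by
  simp [coord, e, Matrix.trace_fin_two, Matrix.mul_apply, Matrix.conjTranspose_apply, map_ofNat]
  ring

lemma coord_succ_e_zero (k : Fin 6) : coord k.succ (e 0) = 0 := by
  fin_cases k
  · exact (coord_one _).trans (by simp [e])
  · exact (coord_two _).trans (by simp [e])
  · exact (coord_three _).trans (by simp [e])
  · exact (coord_four _).trans (by simp [e])
  · exact (coord_five _).trans (by simp [e])
  · exact (coord_six _).trans (by simp [e])

lemma lprod_e0 (X : Mat) : lprod X e0 = coord 0 X := by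
  have h0 : coord 0 (e0 : Mat) = 1 := by
    simp [e0, coord_zero, e, Matrix.trace_fin_two]
    norm_num
  have h : ∀ k : Fin 6, coord k.succ (e0 : Mat) = 0 := coord_succ_e_zero
  simp [lprod, h0, h]

lemma lprod_self (X : Mat) : lprod X X = coord 0 X ^ 2 - sprod X X := by
  simp only [lprod, sprod]
  ring

lemma coord_add (k : Fin 7) (X Y : Mat) : coord k (X + Y) = coord k X + coord k Y := by
  simp only [coord, Matrix.add_mul, Matrix.trace_add, Complex.add_re]
  ring

lemma coord_smul (k : Fin 7) (c : ℝ) (X : Mat) : coord k (c • X) = c * coord k X := by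
  simp only [coord, Matrix.smul_mul, Matrix.trace_smul, Complex.smul_re, smul_eq_mul]
  ring

/-- The coordinates as linear functionals. -/
def coordL (k : Fin 7) : Mat →ₗ[ℝ] ℝ where
  toFun := coord k
  map_add' := coord_add k
  map_smul' := coord_smul k

lemma coord_sub (k : Fin 7) (X Y : Mat) : coord k (X - Y) = coord k X - coord k Y :=
  (coordL k).map_sub X Y

lemma continuous_coord (k : Fin 7) : Continuous (coord k) :=
  (coordL k).continuous_of_finiteDimensional

lemma continuous_sprod : Continuous fun p : Mat × Mat => sprod p.1 p.2 := by
  unfold sprod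
  have := continuous_coord
  fun_prop

lemma continuous_sprod_self : Continuous fun X : Mat => sprod X X := by
  unfold sprod
  have := continuous_coord
  fun_prop

lemma sprod_comm (X Y : Mat) : sprod X Y = sprod Y X := by
  simp only [sprod, mul_comm]

lemma sprod_smul_left (c : ℝ) (X Y : Mat) : sprod (c • X) Y = c * sprod X Y := by
  simp only [sprod, coord_smul, Finset.mul_sum, mul_assoc]

lemma sprod_smul_right (c : ℝ) (X Y : Mat) : sprod X (c • Y) = c * sprod X Y := by
  rw [sprod_comm, sprod_smul_left, sprod_comm]

lemma sprod_add_left (X X' Y : Mat) : sprod (X + X') Y = sprod X Y + sprod X' Y := by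
  simp only [sprod, coord_add, add_mul, Finset.sum_add_distrib]

lemma sprod_sub_left (X X' Y : Mat) : sprod (X - X') Y = sprod X Y - sprod X' Y := by
  simp only [sprod, coord_sub, sub_mul, Finset.sum_sub_distrib]

lemma sprod_sub_right (X Y Y' : Mat) : sprod X (Y - Y') = sprod X Y - sprod X Y' := by
  rw [sprod_comm, sprod_sub_left, sprod_comm Y, sprod_comm Y']

lemma sprod_add_right (X Y Y' : Mat) : sprod X (Y + Y') = sprod X Y + sprod X Y' := by
  rw [sprod_comm, sprod_add_left, sprod_comm Y, sprod_comm Y']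

lemma sprod_self_nonneg (X : Mat) : 0 ≤ sprod X X :=
  Finset.sum_nonneg fun _ _ => mul_self_nonneg _

lemma frobenius_sq (X : Mat) :
    ‖X‖ ^ 2 = ‖X 0 0‖ ^ 2 + ‖X 0 1‖ ^ 2 + (‖X 1 0‖ ^ 2 + ‖X 1 1‖ ^ 2) := by
  rw [Matrix.frobenius_norm_def, ← Real.sqrt_eq_rpow, Real.sq_sqrt (by positivity)]
  simp [Fin.sum_univ_two]

/-- On traceless matrices the scalar product is twice the Frobenius one. -/
lemma sprod_self_of_trace {X : Mat} (h : X.trace = 0) : sprod X X = 2 * ‖X‖ ^ 2 := by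
  rw [frobenius_sq]
  have h11 : X 1 1 = -X 0 0 := by
    rw [Matrix.trace_fin_two] at h
    linear_combination h
  simp only [Complex.sq_norm, Complex.normSq_apply, h11, Complex.neg_re, Complex.neg_im]
  simp [sprod, coord, e, Matrix.trace_fin_two, Fin.sum_univ_succ, Matrix.mul_apply, h11]
  ring

/-- `X` belongs to `H₀`: it is Hermitian and traceless. -/
def IsH0 (X : Mat) : Prop := X.IsHermitian ∧ X.trace = 0

lemma IsH0.sub {X Y : Mat} (hX : IsH0 X) (hY : IsH0 Y) : IsH0 (X - Y) :=
  ⟨hX.1.sub hY.1, by rw [Matrix.trace_sub, hX.2, hY.2, sub_zero]⟩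

lemma IsH0.add {X Y : Mat} (hX : IsH0 X) (hY : IsH0 Y) : IsH0 (X + Y) :=
  ⟨hX.1.add hY.1, by rw [Matrix.trace_add, hX.2, hY.2, add_zero]⟩

lemma IsH0.smul {X : Mat} (hX : IsH0 X) (c : ℝ) : IsH0 (c • X) :=
  ⟨by
    rw [Matrix.IsHermitian, Matrix.conjTranspose_smul, hX.1.eq]
    simp, by rw [Matrix.trace_smul, hX.2, smul_zero]⟩

lemma norm_one_mat_le : ‖(1 : Mat)‖ ≤ 2 := by
  have h := frobenius_sq (1 : Mat)
  simp at h
  nlinarith [norm_nonneg (1 : Mat)]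

/-! ### Velocities -/

/-- The adjugate of `2 × 2` matrices as a continuous linear map. -/
def adjL : Mat →L[ℝ] Mat :=
  LinearMap.toContinuousLinearMap
    { toFun := Matrix.adjugate
      map_add' := fun X Y => by
        ext i j
        fin_cases i <;> fin_cases j <;> simp [Matrix.adjugate_fin_two] <;> ring
      map_smul' := fun c X => by
        ext i j
        fin_cases i <;> fin_cases j <;> simp [Matrix.adjugate_fin_two] }

lemma adjL_apply (X : Mat) : adjL X = X.adjugate := rfl

lemma adjL_mul (X Y : Mat) : adjL (X * Y) = adjL Y * adjL X := by
  simp only [adjL_apply, Matrix.adjugate_mul_distrib]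

lemma adjL_of_trace {X : Mat} (h : X.trace = 0) : adjL X = -X := by
  rw [Matrix.trace_fin_two] at h
  rw [adjL_apply]
  ext i j
  fin_cases i <;> fin_cases j <;> simp [Matrix.adjugate_fin_two] <;> linear_combination h

lemma SL2C.inv_eq (x : SL2C) : (x : Mat)⁻¹ = adjL x := by
  rw [Matrix.inv_def, x.det_coe, adjL_apply]
  simp

lemma SL2C.adjL_mul_self (x : SL2C) : adjL (x : Mat) * x = 1 := by
  rw [adjL_apply, Matrix.adjugate_mul, x.det_coe, one_smul]

lemma SL2C.mul_adjL_self (x : SL2C) : (x : Mat) * adjL x = 1 := by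
  rw [adjL_apply, Matrix.mul_adjugate, x.det_coe, one_smul]

lemma hasDerivAt_entries {c : ℝ → Mat} {c' : Mat} {t : ℝ} :
    HasDerivAt c c' t ↔ ∀ i j, HasDerivAt (fun s => c s i j) (c' i j) t := by
  constructor
  · intro h i j
    exact hasDerivAt_pi.1 (hasDerivAt_pi.1 h i) j
  · intro h
    exact hasDerivAt_pi.2 fun i => hasDerivAt_pi.2 fun j => h i j

lemma deriv_entries {c : ℝ → Mat} {c' : Mat} {t : ℝ} (h : HasDerivAt c c' t) :
    (Matrix.of fun i j => deriv (fun s => c s i j) t) = c' := by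
  ext i j
  exact (hasDerivAt_entries.1 h i j).deriv

lemma velocity_eq {c : ℝ → Mat} {c' : Mat} {t : ℝ} (h : HasDerivAt c c' t) :
    velocity c t = (c t)⁻¹ * c' := by
  rw [velocity, deriv_entries h]

lemma lipschitzOnIcc_iff {c : ℝ → Mat} {a b : ℝ} : LipschitzOnIcc c a b ↔ LipOn c a b := by
  constructor
  · rintro ⟨K, hK⟩
    have hent : ∀ i j, LipOn (fun t => (LinearMap.toContinuousLinearMap
        (Matrix.singleLinearMap ℝ i j : ℂ →ₗ[ℝ] Mat)) (c t i j)) a b :=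
      fun i j => LipOn.clm_comp _ ⟨K, hK i j⟩
    refine ((hent 0 0).add ((hent 0 1).add ((hent 1 0).add (hent 1 1)))).congr fun t _ => ?_
    ext i j
    fin_cases i <;> fin_cases j <;> simp
  · intro h
    have hent : ∀ i j, LipOn (fun t => c t i j) a b := fun i j =>
      h.clm_comp (Matrix.entryLinearMap ℝ ℂ i j).toContinuousLinearMap
    choose K hK using hent
    refine ⟨K 0 0 ⊔ K 0 1 ⊔ K 1 0 ⊔ K 1 1, fun i j => (hK i j).weaken ?_⟩
    fin_cases i <;> fin_cases j <;> simp

/-- A Lipschitz curve of invertible matrices is almost everywhere a solution of `c' = c u`, with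
`u` its velocity. -/
lemma LipOn.ae_hasDerivAt_velocity {c : ℝ → Mat} {a b : ℝ} (h : LipOn c a b)
    (hdet : ∀ t, IsUnit (c t).det) :
    ∀ᵐ t : ℝ, t ∈ Icc a b → HasDerivAt c (c t * velocity c t) t := by
  filter_upwards [h.ae_hasDerivAt] with t ht hm
  rw [velocity_eq (ht hm), Matrix.mul_nonsing_inv_cancel_left _ _ (hdet t)]
  exact ht hm

lemma velS_eq {γ : ℝ → SL2C} {c' : Mat} {t : ℝ} (h : HasDerivAt (fun s => (γ s : Mat)) c' t) :
    velS γ t = adjL (γ t) * c' := by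
  rw [velS, velocity_eq h, SL2C.inv_eq]

lemma velS_eq' {γ : ℝ → SL2C} {v : Mat} {t : ℝ}
    (h : HasDerivAt (fun s => (γ s : Mat)) (γ t * v) t) : velS γ t = v := by
  rw [velS_eq h, ← mul_assoc, SL2C.adjL_mul_self, one_mul]

lemma ae_hasDerivAt_velS {γ : ℝ → SL2C} {a b : ℝ} (h : LipOn (fun t => (γ t : Mat)) a b) :
    ∀ᵐ t : ℝ, t ∈ Icc a b → HasDerivAt (fun s => (γ s : Mat)) (γ t * velS γ t) t :=
  h.ae_hasDerivAt_velocity fun t => by rw [(γ t).det_coe]; exact isUnit_one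

/-- Velocities of curves of unimodular matrices are traceless. -/
lemma trace_velS {γ : ℝ → SL2C} {v : Mat} {t : ℝ}
    (h : HasDerivAt (fun s => (γ s : Mat)) (γ t * v) t) : v.trace = 0 := by
  have hE := hasDerivAt_entries.1 h
  have hdet : HasDerivAt (fun s => (γ s : Mat) 0 0 * (γ s : Mat) 1 1 -
      (γ s : Mat) 0 1 * (γ s : Mat) 1 0)
      (((γ t : Mat) * v) 0 0 * (γ t : Mat) 1 1 + (γ t : Mat) 0 0 * ((γ t : Mat) * v) 1 1 -
        (((γ t : Mat) * v) 0 1 * (γ t : Mat) 1 0 + (γ t : Mat) 0 1 * ((γ t : Mat) * v) 1 0)) t :=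
    ((hE 0 0).mul (hE 1 1)).sub ((hE 0 1).mul (hE 1 0))
  have hone : (fun s => (γ s : Mat) 0 0 * (γ s : Mat) 1 1 -
      (γ s : Mat) 0 1 * (γ s : Mat) 1 0) = fun _ => (1 : ℂ) := by
    funext s
    rw [← Matrix.det_fin_two, (γ s).det_coe]
  rw [hone] at hdet
  have h0 := hdet.unique (hasDerivAt_const t (1 : ℂ))
  have h1 := congrFun hone t
  simp only [Matrix.mul_apply, Fin.sum_univ_two] at h0 h1
  rw [Matrix.trace_fin_two]
  linear_combination h0 - (v 0 0 + v 1 1) * h1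

lemma essBdd_velS {γ : ℝ → SL2C} {a b : ℝ} (h : LipOn (fun t => (γ t : Mat)) a b) :
    EssBdd (velS γ) a b := by
  refine (EssBdd.comp₂ (φ := fun p : Mat × Mat => adjL p.1 * p.2) (by fun_prop) h.essBdd
    h.essBdd_deriv).congr ?_
  filter_upwards [h.ae_hasDerivAt] with t ht hm
  exact velS_eq (ht hm)

lemma essBdd_speed {γ : ℝ → SL2C} {a b : ℝ} (h : LipOn (fun t => (γ t : Mat)) a b) :
    EssBdd (speed γ) a b := by
  have hc : Continuous fun X : Mat => √(sprod X X) :=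
    Real.continuous_sqrt.comp continuous_sprod_self
  have := EssBdd.comp hc (essBdd_velS h)
  exact this

lemma IsHorizontal.lipOn {γ : ℝ → SL2C} {a b : ℝ} (h : IsHorizontal γ a b) :
    LipOn (fun t => (γ t : Mat)) a b := lipschitzOnIcc_iff.1 h.lipschitz

lemma speed_nonneg (γ : ℝ → SL2C) (t : ℝ) : 0 ≤ speed γ t := Real.sqrt_nonneg _

lemma speed_sq (γ : ℝ → SL2C) (t : ℝ) : speed γ t ^ 2 = sprod (velS γ t) (velS γ t) :=
  Real.sq_sqrt (sprod_self_nonneg _)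

/-! ### Reparametrization and left translation -/

lemma ae_comp_affine {p : ℝ → Prop} {c : ℝ} (hc : c ≠ 0) (β : ℝ) (h : ∀ᵐ t : ℝ, p t) :
    ∀ᵐ t : ℝ, p (c * t + β) := by
  rw [ae_iff] at h ⊢
  have h1 : {t : ℝ | ¬p (c * t + β)} =
      (fun t => c * t) ⁻¹' ((fun t => t + β) ⁻¹' {t | ¬p t}) := rfl
  rw [h1, Real.volume_preimage_mul_left hc, measure_preimage_add_right, h, mul_zero]

lemma affine_mem_Icc {c β a b t : ℝ} (hc : 0 < c) (ht : t ∈ Icc a b) :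
    c * t + β ∈ Icc (c * a + β) (c * b + β) :=
  ⟨by have := mul_le_mul_of_nonneg_left ht.1 hc.le; linarith,
    by have := mul_le_mul_of_nonneg_left ht.2 hc.le; linarith⟩

lemma velS_affine {γ : ℝ → SL2C} {a b c β : ℝ} (hc : 0 < c) (x : SL2C)
    (h : LipOn (fun t => (γ t : Mat)) (c * a + β) (c * b + β)) :
    ∀ᵐ t : ℝ, t ∈ Icc a b →
      velS (fun t => x * γ (c * t + β)) t = c • velS γ (c * t + β) := by
  filter_upwards [ae_comp_affine hc.ne' β (ae_hasDerivAt_velS h)] with t ht hm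
  have h1 := ht (affine_mem_Icc hc hm)
  have h2 : HasDerivAt (fun t : ℝ => c * t + β) c t := by
    simpa using ((hasDerivAt_id t).const_mul c).add_const β
  have h3 := (HasDerivAt.scomp t h1 h2).const_mul (x : Mat)
  refine velS_eq' ?_
  convert! h3 using 1
  simp only [Matrix.SpecialLinearGroup.coe_mul, mul_assoc, Matrix.mul_smul]

lemma IsHorizontal.affine {γ : ℝ → SL2C} {a b c β : ℝ} (hc : 0 < c) (x : SL2C)
    (h : IsHorizontal γ (c * a + β) (c * b + β)) :
    IsHorizontal (fun t => x * γ (c * t + β)) a b := by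
  have hL := h.lipOn
  refine ⟨lipschitzOnIcc_iff.2 ?_, ?_⟩
  · obtain ⟨K, hK, hb⟩ := hL.bound
    have hγ : LipOn (fun t => (γ (c * t + β) : Mat)) a b := by
      refine LipOn.of_bound (C := K * c) fun s hs t ht => ?_
      refine (hb _ (affine_mem_Icc hc hs) _ (affine_mem_Icc hc ht)).trans (le_of_eq ?_)
      rw [add_sub_add_right_eq_sub, ← mul_sub, abs_mul, abs_of_pos hc, mul_assoc]
    exact hγ.clm_comp (ContinuousLinearMap.mul ℝ Mat (x : Mat))
  · filter_upwards [velS_affine hc x hL, ae_comp_affine hc.ne' β h.horizontal] with t h1 h2 hm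
    rw [h1 hm]
    exact IsH0.smul (h2 (affine_mem_Icc hc hm)) c

lemma speed_affine {γ : ℝ → SL2C} {c s t : ℝ} {γ' : ℝ → SL2C} (hc : 0 < c)
    (h : velS γ' t = c • velS γ s) : speed γ' t = c * speed γ s := by
  rw [speed, speed, h, sprod_smul_left, sprod_smul_right, ← mul_assoc, ← sq,
    Real.sqrt_mul (sq_nonneg c), Real.sqrt_sq hc.le]

lemma lengthS_affine {γ : ℝ → SL2C} {a b c β : ℝ} (hc : 0 < c) (hab : a ≤ b) (x : SL2C)
    (h : LipOn (fun t => (γ t : Mat)) (c * a + β) (c * b + β)) :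
    lengthS (fun t => x * γ (c * t + β)) a b = lengthS γ (c * a + β) (c * b + β) := by
  have h1 : lengthS (fun t => x * γ (c * t + β)) a b =
      ∫ t in a..b, c * speed γ (c * t + β) := by
    refine intervalIntegral_congr_ae' hab ?_
    filter_upwards [velS_affine hc x h] with t ht hm using speed_affine hc (ht hm)
  rw [h1, intervalIntegral.integral_const_mul,
    intervalIntegral.integral_comp_mul_add _ hc.ne', smul_eq_mul, mul_inv_cancel_left₀ hc.ne']
  rfl

lemma rho_le_lengthS {γ : ℝ → SL2C} {a b : ℝ} (hab : a < b) (h : IsHorizontal γ a b) :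
    rho (γ a) (γ b) ≤ (lengthS γ a b : EReal) := by
  have h' : IsHorizontal γ (1 * 0 + a) (1 * (b - a) + a) := by simpa using h
  have hl := lengthS_affine one_pos (sub_nonneg.2 hab.le) 1 h'.lipOn
  refine sInf_le ⟨_, b - a, sub_pos.2 hab, h'.affine one_pos 1, by simp, by simp, ?_⟩
  rw [hl]
  simp

lemma isShortestArc_of_forall_le {γ : ℝ → SL2C} {a b : ℝ} (hab : a < b)
    (h : IsHorizontal γ a b)
    (hmin : ∀ (c : ℝ → SL2C) (T : ℝ), 0 < T → IsHorizontal c 0 T → c 0 = γ a → c T = γ b →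
      lengthS γ a b ≤ lengthS c 0 T) : IsShortestArc γ a b := by
  refine ⟨hab, h, le_antisymm (le_sInf ?_) (rho_le_lengthS hab h)⟩
  rintro L ⟨c, T, hT, hc, h0, h1, rfl⟩
  exact_mod_cast hmin c T hT hc h0 h1

lemma IsShortestArc.le {γ : ℝ → SL2C} {a b : ℝ} (h : IsShortestArc γ a b) {c : ℝ → SL2C} {T : ℝ}
    (hT : 0 < T) (hc : IsHorizontal c 0 T) (h0 : c 0 = γ a) (h1 : c T = γ b) :
    lengthS γ a b ≤ lengthS c 0 T := by
  have h2 : (lengthS γ a b : EReal) ≤ (lengthS c 0 T : EReal) := by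
    rw [h.2.2]
    exact sInf_le ⟨c, T, hT, hc, h0, h1, rfl⟩
  exact_mod_cast h2

lemma IsShortestArc.affine {γ : ℝ → SL2C} {a b c β : ℝ} (hc : 0 < c) (x : SL2C)
    (h : IsShortestArc γ (c * a + β) (c * b + β)) :
    IsShortestArc (fun t => x * γ (c * t + β)) a b := by
  have hab : a < b := by
    have := h.1
    by_contra hn
    have := mul_le_mul_of_nonneg_left (not_lt.1 hn) hc.le
    linarith
  refine isShortestArc_of_forall_le hab (h.2.1.affine hc x) fun k T hT hk h0 h1 => ?_
  rw [lengthS_affine hc hab.le x h.2.1.lipOn]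
  have hk' : IsHorizontal k (1 * 0 + 0) (1 * T + 0) := by simpa using hk
  have hl := lengthS_affine one_pos hT.le x⁻¹ hk'.lipOn
  have := h.le hT (hk'.affine one_pos x⁻¹) (by simp [h0]) (by simp [h1])
  rw [hl] at this
  simpa using this

lemma isShortestArc_comp_mul_iff {γ : ℝ → SL2C} {a b c : ℝ} (hc : 0 < c) :
    IsShortestArc (fun t => γ (c * t)) a b ↔ IsShortestArc γ (c * a) (c * b) := by
  constructor
  · intro h
    have h' : IsShortestArc (fun t => γ (c * t)) (c⁻¹ * (c * a) + 0) (c⁻¹ * (c * b) + 0) := by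
      simpa [inv_mul_cancel_left₀ hc.ne'] using h
    have := h'.affine (inv_pos.2 hc) 1
    simpa [mul_inv_cancel_left₀ hc.ne'] using this
  · intro h
    have h' : IsShortestArc γ (c * a + 0) (c * b + 0) := by simpa using h
    simpa using h'.affine hc 1

lemma IsRiemGeodesic.comp_mul {γ : ℝ → SL2C} {c : ℝ} (hc : 0 < c) (h : IsRiemGeodesic γ) :
    IsRiemGeodesic (fun t => γ (c * t)) := by
  intro t
  obtain ⟨ε, hε, hs⟩ := h (c * t)
  refine ⟨c⁻¹ * ε, by positivity, (isShortestArc_comp_mul_iff hc).2 ?_⟩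
  rw [mul_sub, mul_add, mul_inv_cancel_left₀ hc.ne']
  exact hs

/-! ### Short segments of normal extremals are shortest -/

/-- A unit speed horizontal curve `γ' = γ V` in `SL(2,ℂ)` that is a normal extremal of the
sub-Riemannian length: moved to the unit by right shifts, the covector that represents the velocity
on `H₀` is the constant `lam`. -/
structure IsUnitNormal (γ : ℝ → SL2C) (V : ℝ → Mat) (lam : Mat →ₗ[ℝ] ℝ) : Prop where
  cont : Continuous V
  hasDerivAt : ∀ t, HasDerivAt (fun s => (γ s : Mat)) (γ t * V t) t
  isH0 : ∀ t, IsH0 (V t)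
  unit : ∀ t, sprod (V t) (V t) = 1
  covector : ∀ t w, IsH0 w → lam (γ t * w * adjL (γ t)) = sprod (V t) w

lemma IsUnitNormal.continuous {γ : ℝ → SL2C} {V : ℝ → Mat} {lam : Mat →ₗ[ℝ] ℝ}
    (h : IsUnitNormal γ V lam) : Continuous fun t => (γ t : Mat) :=
  continuous_iff_continuousAt.2 fun t => (h.hasDerivAt t).continuousAt

lemma IsUnitNormal.velS {γ : ℝ → SL2C} {V : ℝ → Mat} {lam : Mat →ₗ[ℝ] ℝ}
    (h : IsUnitNormal γ V lam) (t : ℝ) : velS γ t = V t := velS_eq' (h.hasDerivAt t)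

lemma IsUnitNormal.speed {γ : ℝ → SL2C} {V : ℝ → Mat} {lam : Mat →ₗ[ℝ] ℝ}
    (h : IsUnitNormal γ V lam) (t : ℝ) : speed γ t = 1 := by
  rw [SubLorentz.speed, h.velS, h.unit, Real.sqrt_one]

lemma IsUnitNormal.isHorizontal {γ : ℝ → SL2C} {V : ℝ → Mat} {lam : Mat →ₗ[ℝ] ℝ}
    (h : IsUnitNormal γ V lam) (a b : ℝ) : IsHorizontal γ a b := by
  refine ⟨lipschitzOnIcc_iff.2 (LipOn.of_hasDerivAt (fun t _ => h.hasDerivAt t)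
    (h.continuous.mul h.cont).continuousOn), Filter.Eventually.of_forall fun t _ => ?_⟩
  rw [h.velS]
  exact h.isH0 t

lemma IsUnitNormal.lengthS {γ : ℝ → SL2C} {V : ℝ → Mat} {lam : Mat →ₗ[ℝ] ℝ}
    (h : IsUnitNormal γ V lam) (a b : ℝ) : lengthS γ a b = b - a := by
  simp [SubLorentz.lengthS, h.speed]

/-- A horizontal curve `h` with the end points of a short segment of a normal curve `γ` is not
shorter. Run along `γ` at the speed `s` of `h`, slightly increased, and compare the velocities
`w` of `h` and `s v` of `γ`. The covector turns `∫ ⟨v, w⟩` into the length `T` of the segment plus the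
holonomy of the loop `γ h⁻¹`, which is at most of the order of the square of `N = ∫ |w - s v|`. The
convexity of the squared norm gains the term `N² / T`, which for small `T` absorbs the holonomy. -/
lemma IsUnitNormal.le_lengthS {γ : ℝ → SL2C} {V : ℝ → Mat} {lam : Mat →ₗ[ℝ] ℝ}
    (hγ : IsUnitNormal γ V lam) {t₁ t₂ B Λ : ℝ} (h12 : t₁ < t₂) (hB0 : 0 < B)
    (hΛ0 : 0 ≤ Λ) (hlam : ∀ x, |lam x| ≤ Λ * ‖x‖)
    (hB : ∀ t ∈ Icc t₁ t₂, ‖(γ t : Mat)‖ * ‖adjL (γ t : Mat)‖ ≤ B)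
    (hT : (t₂ - t₁) * (8 * Λ * B ^ 2 + 4 * B + 1) ≤ 1)
    {h : ℝ → SL2C} {a : ℝ} (ha : 0 < a) (hh : IsHorizontal h 0 a) (h0 : h 0 = γ t₁)
    (h1 : h a = γ t₂) : t₂ - t₁ ≤ SubLorentz.lengthS h 0 a := by
  by_contra hlt
  rw [not_le] at hlt
  set T := t₂ - t₁ with hTdef
  have hT0 : 0 < T := sub_pos.2 h12
  set ℓ := SubLorentz.lengthS h 0 a with hℓ
  set δ := (T - ℓ) / a with hδ
  have hδ0 : 0 < δ := div_pos (sub_pos.2 hlt) ha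
  have hhL := hh.lipOn
  set w := SubLorentz.velS h with hw
  have hwE : EssBdd w 0 a := essBdd_velS hhL
  have hσE : EssBdd (SubLorentz.speed h) 0 a := essBdd_speed hhL
  -- the parameter of `γ` that runs at the speed of the competitor, slightly increased so that
  -- both curves arrive simultaneously
  set s : ℝ → ℝ := fun t => SubLorentz.speed h t + δ with hs
  have hs0 : ∀ t, 0 < s t := fun t => add_pos_of_nonneg_of_pos (speed_nonneg h t) hδ0
  have hsE : EssBdd s 0 a := hσE.comp (φ := fun x => x + δ) (by fun_prop)
  have hsint : ∫ t in 0..a, s t = T := by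
    rw [hs, intervalIntegral.integral_add (hσE.intervalIntegrable ha.le)
      intervalIntegrable_const]
    change ℓ + _ = T
    rw [intervalIntegral.integral_const, hδ, sub_zero, smul_eq_mul]
    field_simp
    ring
  set τ : ℝ → ℝ := fun t => t₁ + ∫ x in 0..t, s x with hτ
  have hτL : LipOn τ 0 a := by
    obtain ⟨C, -, hC⟩ := (hsE.lipOn_integral ha.le).bound
    refine LipOn.of_bound (C := C) fun x hx y hy => ?_
    simp only [hτ, add_sub_add_left_eq_sub]
    exact hC x hx y hy
  have hτ0 : τ 0 = t₁ := by simp [hτ]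
  have hτa : τ a = t₂ := by simp only [hτ, hsint, hTdef]; ring
  have hτm : MapsTo τ (Icc 0 a) (Icc t₁ t₂) := by
    intro t ht
    have hnn : 0 ≤ ∫ x in 0..t, s x :=
      intervalIntegral.integral_nonneg ht.1 fun x _ => (hs0 x).le
    have hle : ∫ x in 0..t, s x ≤ ∫ x in 0..a, s x :=
      intervalIntegral.integral_mono_interval le_rfl ht.1 ht.2
        (Filter.Eventually.of_forall fun x => (hs0 x).le) (hsE.intervalIntegrable ha.le)
    rw [hsint] at hle
    simp only [hτ, mem_Icc]
    constructor <;> linarith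
  have hτd : ∀ᵐ t : ℝ, t ∈ Icc 0 a → HasDerivAt τ (s t) t := by
    filter_upwards [hsE.ae_hasDerivAt_integral ha.le] with t ht hm
    exact (ht hm).const_add t₁
  have hγτL : LipOn (fun t => (γ (τ t) : Mat)) 0 a :=
    LipOn.comp_lipschitz (f := fun t => (γ t : Mat)) (hγ.isHorizontal t₁ t₂).lipOn hτL hτm
  set P : ℝ → Mat := fun t => (γ (τ t) : Mat) with hP
  set v : ℝ → Mat := fun t => V (τ t) with hv
  have hvE : EssBdd v 0 a :=
    EssBdd.of_continuousOn (hγ.cont.comp_continuousOn hτL.continuousOn)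
  set y : ℝ → Mat := fun t => w t - s t • v t with hy
  have hyE : EssBdd y 0 a := by
    have h1 : EssBdd (fun t => s t • v t) 0 a :=
      EssBdd.comp₂ (φ := fun p : ℝ × Mat => p.1 • p.2) (by fun_prop) hsE hvE
    exact EssBdd.comp₂ (φ := fun p : Mat × Mat => p.1 - p.2) (by fun_prop) hwE h1
  set z : ℝ → Mat := fun t => P t * y t * adjL (P t) with hz
  have hzE : EssBdd z 0 a :=
    EssBdd.comp₂ (φ := fun p : Mat × Mat => p.1 * p.2 * adjL p.1) (by fun_prop) hγτL.essBdd hyE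
  -- the loop that measures the deviation of the two curves; its right velocity is `-z`
  set j : ℝ → Mat := fun t => P t * adjL (h t) with hj
  have hjL : LipOn j 0 a := hγτL.mul (hhL.clm_comp adjL)
  have hjd : ∀ᵐ t : ℝ, t ∈ Icc 0 a → HasDerivAt j (-(z t * j t)) t := by
    filter_upwards [hτd, ae_hasDerivAt_velS hhL] with t hτt hht hm
    have hPd : HasDerivAt P (s t • (P t * v t)) t :=
      HasDerivAt.scomp t (hγ.hasDerivAt (τ t)) (hτt hm)
    have hAd : HasDerivAt (fun t => adjL (h t : Mat)) (adjL ((h t : Mat) * w t)) t :=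
      adjL.hasFDerivAt.comp_hasDerivAt t (hht hm)
    have htr : adjL (w t) = -w t := adjL_of_trace (trace_velS (hht hm))
    convert! hPd.mul hAd using 1
    rw [adjL_mul, htr]
    have hPP : adjL (P t) * P t = 1 := SL2C.adjL_mul_self _
    have hzj : z t * j t = P t * y t * adjL (h t : Mat) := by
      simp only [hz, hj]
      calc P t * y t * adjL (P t) * (P t * adjL (h t : Mat))
          = P t * y t * (adjL (P t) * P t) * adjL (h t : Mat) := by noncomm_ring
        _ = _ := by rw [hPP, mul_one]
    rw [hzj]
    simp only [hy, mul_sub, sub_mul, neg_mul, mul_neg, mul_smul_comm, smul_mul_assoc, mul_assoc]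
    abel
  set n : ℝ → ℝ := fun t => √(sprod (y t) (y t)) with hn
  have hnE : EssBdd n 0 a := by
    have hc : Continuous fun X : Mat => √(sprod X X) :=
      Real.continuous_sqrt.comp continuous_sprod_self
    have := EssBdd.comp hc hyE
    exact this
  have hn0 : ∀ t, 0 ≤ n t := fun t => Real.sqrt_nonneg _
  set p : ℝ → ℝ := fun t => sprod (v t) (w t) with hp
  have hpE : EssBdd p 0 a := EssBdd.comp₂ continuous_sprod hvE hwE
  have hsq : ∀ t, n t ^ 2 = SubLorentz.speed h t ^ 2 - 2 * s t * p t + s t ^ 2 := by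
    intro t
    simp only [hn]
    rw [Real.sq_sqrt (sprod_self_nonneg _), speed_sq]
    simp only [hy, hp, sprod_sub_left, sprod_sub_right, sprod_smul_left, sprod_smul_right]
    rw [show sprod (v t) (v t) = 1 from hγ.unit _, sprod_comm (w t) (v t)]
    ring
  have hn2s : ∀ t, n t ≤ 2 * s t := by
    intro t
    have h2 : 0 ≤ sprod (w t + s t • v t) (w t + s t • v t) := sprod_self_nonneg _
    simp only [sprod_add_left, sprod_add_right, sprod_smul_left, sprod_smul_right] at h2
    rw [show sprod (v t) (v t) = 1 from hγ.unit _, sprod_comm (w t) (v t),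
      ← speed_sq] at h2
    have h3 := hsq t
    have h4 : SubLorentz.speed h t ≤ s t := by simp only [hs]; linarith
    have h5 : SubLorentz.speed h t ^ 2 ≤ s t ^ 2 :=
      pow_le_pow_left₀ (speed_nonneg h t) h4 2
    have hpd : p t = sprod (v t) (w t) := rfl
    rw [← hpd] at h2
    exact abs_le_of_sq_le_sq' (by nlinarith) (by linarith [hs0 t]) |>.2
  have hyH : ∀ᵐ t : ℝ, t ∈ Icc 0 a → IsH0 (y t) := by
    filter_upwards [hh.horizontal] with t ht hm
    exact IsH0.sub (ht hm) ((hγ.isH0 _).smul _)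
  have hzn : ∀ᵐ t : ℝ, t ∈ Icc 0 a → ‖z t‖ ≤ B * n t := by
    filter_upwards [hyH] with t ht hm
    have h2 : ‖y t‖ ≤ n t := by
      simp only [hn]
      refine Real.le_sqrt_of_sq_le ?_
      rw [sprod_self_of_trace (ht hm).2]
      nlinarith [sq_nonneg ‖y t‖]
    calc ‖z t‖ ≤ ‖P t * y t‖ * ‖adjL (P t)‖ := norm_mul_le _ _
      _ ≤ ‖P t‖ * ‖y t‖ * ‖adjL (P t)‖ := by gcongr; exact norm_mul_le _ _
      _ = (‖P t‖ * ‖adjL (P t)‖) * ‖y t‖ := by ring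
      _ ≤ B * n t := by
        gcongr
        exact hB _ (hτm hm)
  set N := ∫ t in 0..a, n t with hN
  have hN0 : 0 ≤ N := intervalIntegral.integral_nonneg ha.le fun x _ => hn0 x
  have hN2 : N ≤ 2 * T := by
    have := intervalIntegral_mono_ae ha.le hnE (hsE.comp (φ := fun x => 2 * x) (by fun_prop))
      (Filter.Eventually.of_forall fun t _ => hn2s t)
    rwa [intervalIntegral.integral_const_mul, hsint] at this
  have hlamz : ∀ᵐ t : ℝ, t ∈ Icc 0 a → lam (z t) = p t - s t := by
    filter_upwards [hh.horizontal, hyH] with t ht hyt hm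
    have h2 := hγ.covector (τ t) (y t) (hyt hm)
    have h3 : lam (z t) = sprod (v t) (y t) := h2
    rw [h3]
    simp only [hy, hp, sprod_sub_right, sprod_smul_right]
    rw [show sprod (v t) (v t) = 1 from hγ.unit _, mul_one]
  -- the first variation of the length reduces to the holonomy term
  have hpint : ∫ t in 0..a, p t = T + ∫ t in 0..a, lam (z t) := by
    rw [intervalIntegral_congr_ae' ha.le hlamz,
      intervalIntegral.integral_sub (hpE.intervalIntegrable ha.le)
        (hsE.intervalIntegrable ha.le), hsint]
    ring
  have hΛ := abs_integral_le_of_loop ha.le hjL hzE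
    (hnE.comp (φ := fun x => B * x) (by fun_prop)) hjd hzn
    (by simp only [hj, hP, hτ0, h0]; exact SL2C.mul_adjL_self _)
    (by simp only [hj, hP, hτa, h1]; exact SL2C.mul_adjL_self _) norm_one_mat_le
    (by
      rw [intervalIntegral.integral_const_mul]
      have h8 : 0 ≤ 8 * Λ * B ^ 2 := by positivity
      nlinarith [mul_nonneg hT0.le h8, mul_le_mul_of_nonneg_left hN2 hB0.le]) lam hΛ0 hlam
  rw [intervalIntegral.integral_const_mul] at hΛ
  -- the inequality of the means for `n`, with the factor `x` to be chosen as `N / T`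
  have key : ∀ x : ℝ, 2 * x * N ≤ x ^ 2 * T + (ℓ - 2 * (∫ t in 0..a, p t) + T) := by
    intro x
    have hE : EssBdd (fun t => x ^ 2 * s t + (SubLorentz.speed h t - 2 * p t + s t)) 0 a := by
      have h1 := hsE.comp (φ := fun y => x ^ 2 * y) (by fun_prop)
      have h2 := hσE.comp₂ (φ := fun q : ℝ × ℝ => q.1 - 2 * q.2) (by fun_prop) hpE
      have h3 := h2.comp₂ (φ := fun q : ℝ × ℝ => q.1 + q.2) (by fun_prop) hsE
      exact h1.comp₂ (φ := fun q : ℝ × ℝ => q.1 + q.2) (by fun_prop) h3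
    have hle := intervalIntegral_mono_ae ha.le
      (hnE.comp (φ := fun y => 2 * x * y) (by fun_prop)) hE
      (Filter.Eventually.of_forall fun t _ => by
        have h3 := hsq t
        have h4 : 0 ≤ SubLorentz.speed h t := speed_nonneg h t
        have h5 : SubLorentz.speed h t ≤ s t := by simp only [hs]; linarith
        refine le_of_mul_le_mul_left ?_ (hs0 t)
        nlinarith [sq_nonneg (x * s t - n t), mul_nonneg h4 (sub_nonneg.2 h5)])
    rw [intervalIntegral.integral_const_mul] at hle
    refine hle.trans (le_of_eq ?_)
    have i1 := hsE.intervalIntegrable ha.le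
    have i2 := hσE.intervalIntegrable ha.le
    have i3 := hpE.intervalIntegrable ha.le
    rw [intervalIntegral.integral_add (i1.const_mul _) ((i2.sub (i3.const_mul _)).add i1),
      intervalIntegral.integral_add (i2.sub (i3.const_mul _)) i1,
      intervalIntegral.integral_sub i2 (i3.const_mul _),
      intervalIntegral.integral_const_mul, intervalIntegral.integral_const_mul, hsint]
    rfl
  have hx := key (N / T)
  rw [hpint] at hx
  have hNT : 2 * (N / T) * N = 2 * (N ^ 2 / T) := by ring
  have hNT' : (N / T) ^ 2 * T = N ^ 2 / T := by field_simp
  rw [hNT, hNT'] at hx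
  have hΛ' := neg_le_of_abs_le hΛ
  have hfin : 8 * Λ * B ^ 2 * N ^ 2 ≤ N ^ 2 / T := by
    rw [le_div_iff₀ hT0]
    have h8 : T * (8 * Λ * B ^ 2) ≤ 1 := by nlinarith
    nlinarith [mul_le_mul_of_nonneg_right h8 (sq_nonneg N)]
  nlinarith

/-- Normal curves are geodesics: they are shortest over short segments. -/
lemma IsUnitNormal.isRiemGeodesic {γ : ℝ → SL2C} {V : ℝ → Mat} {lam : Mat →ₗ[ℝ] ℝ}
    (hγ : IsUnitNormal γ V lam) : IsRiemGeodesic γ := by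
  intro t
  have hc : ContinuousOn (fun t => ‖(γ t : Mat)‖ * ‖adjL (γ t : Mat)‖) (Icc (t - 1) (t + 1)) := by
    have := hγ.continuous
    fun_prop
  obtain ⟨Λ, hΛ0, hlam⟩ : ∃ Λ : ℝ, 0 ≤ Λ ∧ ∀ x, |lam x| ≤ Λ * ‖x‖ := by
    obtain ⟨Λ, hΛ0, hΛ⟩ :=
      SemilinearMapClass.bound_of_continuous lam lam.continuous_of_finiteDimensional
    exact ⟨Λ, hΛ0.le, hΛ⟩
  obtain ⟨B', hB'⟩ := isCompact_Icc.exists_bound_of_continuousOn hc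
  set B := max B' 1
  have hB0 : 0 < B := lt_of_lt_of_le one_pos (le_max_right _ _)
  set K := 8 * Λ * B ^ 2 + 4 * B + 1 with hK
  have hK1 : 1 ≤ K := by
    have : 0 ≤ 8 * Λ * B ^ 2 := by positivity
    linarith
  have hK0 : 0 < K := by linarith
  have hε1 : 1 / (2 * K) ≤ 1 := by
    rw [div_le_one (by positivity)]
    linarith
  have hε : 0 < 1 / (2 * K) := by positivity
  refine ⟨1 / (2 * K), hε, ?_⟩
  refine isShortestArc_of_forall_le (by linarith) (hγ.isHorizontal _ _)
    fun h a ha hh h0 h1 => ?_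
  rw [hγ.lengthS]
  refine hγ.le_lengthS (by linarith) hB0 hΛ0 hlam (fun s hs => ?_) ?_ ha hh h0 h1
  · refine (le_abs_self _).trans ((hB' s ⟨?_, ?_⟩).trans (le_max_left _ _))
    · linarith [hs.1]
    · linarith [hs.2]
  · refine le_of_eq ?_
    rw [← hK]
    field_simp
    ring

/-! ### The splitting of `GL⁺(2,ℂ)` -/

lemma mat_injective : Function.Injective mat := fun _ _ h =>
  Subtype.ext (Units.ext h)

lemma mat_mul (x y : GLp) : mat (x * y) = mat x * mat y := rfl

lemma mat_one : mat 1 = 1 := rfl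

lemma mat_expLift (s : ℝ) (x : SL2C) : mat (expLift s x) = Real.exp (s / 2) • (x : Mat) := by
  rw [← Complex.coe_smul]
  rfl

/-- The logarithm of the determinant on `GL⁺(2,ℂ)`. -/
def logdet (y : GLp) : ℝ := Real.log (mat y).det.re

lemma det_mat_re_pos (y : GLp) : 0 < (mat y).det.re := y.2.1

lemma det_mat (y : GLp) : (mat y).det = ((Real.exp (logdet y) : ℝ) : ℂ) := by
  rw [logdet, Real.exp_log (det_mat_re_pos y)]
  exact Complex.ext (by simp) (by rw [Complex.ofReal_im]; exact y.2.2)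

lemma isUnit_det_mat (y : GLp) : IsUnit (mat y).det := by
  rw [det_mat, isUnit_iff_ne_zero, Complex.ofReal_ne_zero]
  exact (Real.exp_pos _).ne'

/-- The unimodular part of an element of `GL⁺(2,ℂ)`. -/
def slPart (y : GLp) : SL2C := ⟨Real.exp (-(logdet y / 2)) • mat y, by
  rw [← Complex.coe_smul, Matrix.det_smul, det_mat, Fintype.card_fin, ← Complex.ofReal_pow,
    ← Complex.ofReal_mul, ← Real.exp_nat_mul, ← Real.exp_add]
  norm_num
  ring_nf
  simp⟩

lemma coe_slPart (y : GLp) : (slPart y : Mat) = Real.exp (-(logdet y / 2)) • mat y := rfl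

lemma expLift_logdet_slPart (y : GLp) : expLift (logdet y) (slPart y) = y := by
  refine mat_injective ?_
  rw [mat_expLift, coe_slPart, smul_smul, ← Real.exp_add]
  simp

lemma logdet_expLift (s : ℝ) (x : SL2C) : logdet (expLift s x) = s := by
  rw [logdet, mat_expLift, ← Complex.coe_smul, Matrix.det_smul, x.det_coe, Fintype.card_fin,
    mul_one, ← Complex.ofReal_pow, Complex.ofReal_re, ← Real.exp_nat_mul, Real.log_exp]
  push_cast
  ring

lemma slPart_expLift (s : ℝ) (x : SL2C) : slPart (expLift s x) = x := by
  refine Subtype.ext ?_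
  change (slPart (expLift s x) : Mat) = x
  rw [coe_slPart, logdet_expLift, mat_expLift, smul_smul, ← Real.exp_add]
  simp

lemma expLift_mul (s s' : ℝ) (x x' : SL2C) :
    expLift s x * expLift s' x' = expLift (s + s') (x * x') := by
  refine mat_injective ?_
  rw [mat_mul, mat_expLift, mat_expLift, mat_expLift, Matrix.SpecialLinearGroup.coe_mul,
    smul_mul_smul_comm, ← Real.exp_add, add_div]

lemma expLift_zero_one : expLift 0 1 = 1 := by
  refine mat_injective ?_
  rw [mat_expLift, mat_one]
  simp

lemma expLift_inv (s : ℝ) (x : SL2C) : (expLift s x)⁻¹ = expLift (-s) x⁻¹ := by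
  rw [inv_eq_iff_mul_eq_one, expLift_mul, add_neg_cancel, mul_inv_cancel, expLift_zero_one]

/-! ### Velocities under the splitting -/

lemma smul_e_zero (c : ℝ) : c • e 0 = (c / 2) • (1 : Mat) := by
  ext i j
  fin_cases i <;> fin_cases j <;> simp [e] <;> ring

lemma coord_zero_add {w : Mat} (c : ℝ) (hw : w.trace = 0) : coord 0 (c • e 0 + w) = c := by
  rw [coord_zero, Matrix.trace_add, hw, smul_e_zero, add_zero]
  simp

lemma coord_succ_add (k : Fin 6) (c : ℝ) (w : Mat) :
    coord k.succ (c • e 0 + w) = coord k.succ w := by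
  rw [coord_add, coord_smul, coord_succ_e_zero, mul_zero, zero_add]

lemma lprod_add_self {w : Mat} (c : ℝ) (hw : w.trace = 0) :
    lprod (c • e 0 + w) (c • e 0 + w) = c ^ 2 - sprod w w := by
  rw [lprod_self, coord_zero_add c hw]
  simp only [sprod, coord_succ_add]

lemma isHermitian_smul_e_zero (c : ℝ) : (c • e 0).IsHermitian := by
  rw [smul_e_zero, Matrix.IsHermitian, Matrix.conjTranspose_smul]
  simp

lemma isHermitian_smul_e_zero_add_iff (c : ℝ) (w : Mat) :
    (c • e 0 + w).IsHermitian ↔ w.IsHermitian := by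
  constructor
  · intro h
    simpa using h.sub (isHermitian_smul_e_zero c)
  · exact (isHermitian_smul_e_zero c).add

lemma velG_expLift {s : ℝ → ℝ} {h : ℝ → SL2C} {s' t : ℝ} {w : Mat} (hs : HasDerivAt s s' t)
    (hh : HasDerivAt (fun t => (h t : Mat)) (h t * w) t) :
    velG (fun t => expLift (s t) (h t)) t = s' • e 0 + w := by
  have h1 : HasDerivAt (fun t => Real.exp (s t / 2)) (Real.exp (s t / 2) * (s' / 2)) t :=
    (hs.div_const 2).exp
  have h2 : HasDerivAt (fun t => mat (expLift (s t) (h t)))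
      (mat (expLift (s t) (h t)) * (s' • e 0 + w)) t := by
    have h3 := h1.smul hh
    simp only [mat_expLift]
    convert! h3 using 1
    rw [smul_e_zero, mul_add, smul_mul_assoc, smul_mul_assoc, mul_smul_comm, mul_one, mul_smul,
      add_comm]
  rw [velG, velocity_eq h2, Matrix.nonsing_inv_mul_cancel_left _ _ (isUnit_det_mat _)]

lemma LipOn.comp_of_hasDerivAt {φ φ' s : ℝ → ℝ} {a b c d : ℝ} (hs : LipOn s a b)
    (hm : MapsTo s (Icc a b) (Icc c d)) (hφ : ∀ x ∈ Icc c d, HasDerivAt φ (φ' x) x)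
    (hc : ContinuousOn φ' (Icc c d)) : LipOn (fun t => φ (s t)) a b :=
  (LipOn.of_hasDerivAt hφ hc).comp_lipschitz hs hm

lemma LipOn.exp {s : ℝ → ℝ} {a b : ℝ} (hs : LipOn s a b) :
    LipOn (fun t => Real.exp (s t)) a b := by
  obtain ⟨C, -, hC⟩ := hs.bounded
  exact hs.comp_of_hasDerivAt (c := -C) (d := C) (fun t ht => abs_le.1 (hC t ht))
    (fun x _ => Real.hasDerivAt_exp x) Real.continuous_exp.continuousOn

lemma LipOn.const_mul {s : ℝ → ℝ} {a b : ℝ} (c : ℝ) (hs : LipOn s a b) :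
    LipOn (fun t => c * s t) a b := by
  have := hs.clm_comp (c • ContinuousLinearMap.id ℝ ℝ)
  simpa using this

lemma lipOn_mat_expLift {s : ℝ → ℝ} {h : ℝ → SL2C} {a b : ℝ} (hs : LipOn s a b)
    (hh : LipOn (fun t => (h t : Mat)) a b) : LipOn (fun t => mat (expLift (s t) (h t))) a b := by
  simp only [mat_expLift]
  refine LipOn.smul (LipOn.exp ?_) hh
  refine (hs.const_mul (1 / 2)).congr fun t _ => by ring

lemma lipOn_logdet {f : ℝ → GLp} {a b : ℝ} (hf : LipOn (fun t => mat (f t)) a b) :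
    LipOn (fun t => logdet (f t)) a b := by
  have hent : ∀ i j, LipOn (fun t => mat (f t) i j) a b := fun i j =>
    hf.clm_comp (Matrix.entryLinearMap ℝ ℂ i j).toContinuousLinearMap
  have hdet : LipOn (fun t => (mat (f t)).det.re) a b := by
    have h1 := ((hent 0 0).mul (hent 1 1)).add
      (((hent 0 1).mul (hent 1 0)).clm_comp (-ContinuousLinearMap.id ℝ ℂ))
    refine (h1.clm_comp Complex.reCLM).congr fun t _ => ?_
    rw [Matrix.det_fin_two]
    simp [sub_eq_add_neg]
  rcases lt_or_ge b a with hba | hab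
  · exact ⟨0, by simp [Icc_eq_empty (not_le.2 hba)]⟩
  obtain ⟨tm, htm, hmin⟩ :=
    isCompact_Icc.exists_isMinOn (nonempty_Icc.2 hab) hdet.continuousOn
  obtain ⟨C, -, hC⟩ := hdet.bounded
  have hpos := det_mat_re_pos (f tm)
  refine hdet.comp_of_hasDerivAt (c := (mat (f tm)).det.re) (d := C)
    (fun t ht => ⟨hmin ht, (le_abs_self _).trans (hC t ht)⟩)
    (fun x hx => Real.hasDerivAt_log (hpos.trans_le hx.1).ne') ?_
  exact continuousOn_inv₀.mono fun x hx => (hpos.trans_le hx.1).ne'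

lemma lipOn_slPart {f : ℝ → GLp} {a b : ℝ} (hf : LipOn (fun t => mat (f t)) a b) :
    LipOn (fun t => (slPart (f t) : Mat)) a b := by
  simp only [coe_slPart]
  refine LipOn.smul (LipOn.exp ?_) hf
  exact ((lipOn_logdet hf).const_mul (-1 / 2)).congr fun t _ => by ring

/-- The velocity of a curve in `GL⁺(2,ℂ)` splits into that of the logarithm of the determinant
and that of the unimodular part. -/
lemma velG_eq_add {f : ℝ → GLp} {a b : ℝ} (hf : LipOn (fun t => mat (f t)) a b) :
    ∀ᵐ t : ℝ, t ∈ Icc a b →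
      velG f t = deriv (fun s => logdet (f s)) t • e 0 + velS (fun s => slPart (f s)) t ∧
      (velS (fun s => slPart (f s)) t).trace = 0 := by
  filter_upwards [(lipOn_logdet hf).ae_hasDerivAt, ae_hasDerivAt_velS (lipOn_slPart hf)]
    with t h1 h2 hm
  have h3 := velG_expLift (h1 hm) (h2 hm)
  simp only [expLift_logdet_slPart] at h3
  exact ⟨h3, trace_velS (h2 hm)⟩

lemma IsFutureNonspacelike.lipOn {f : ℝ → GLp} {a b : ℝ} (h : IsFutureNonspacelike f a b) :
    LipOn (fun t => mat (f t)) a b := lipschitzOnIcc_iff.1 h.lipschitz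

/-- Curves in `SL(2,ℂ)` lifted with a rate of growth of the determinant that is at least their
speed are future directed nonspacelike. -/
lemma isFutureNonspacelike_expLift {h : ℝ → SL2C} {s s' : ℝ → ℝ} {a b : ℝ} (hab : a ≤ b)
    (hh : IsHorizontal h a b) (hs : LipOn s a b)
    (hd : ∀ᵐ t : ℝ, t ∈ Icc a b → HasDerivAt s (s' t) t)
    (hle : ∀ᵐ t : ℝ, t ∈ Icc a b → speed h t ≤ s' t)
    (hpos : ∀ᵐ t : ℝ, t ∈ Icc a b → 0 < s' t) :
    IsFutureNonspacelike (fun t => expLift (s t) (h t)) a b ∧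
      lengthG (fun t => expLift (s t) (h t)) a b =
        ∫ t in a..b, √(s' t ^ 2 - speed h t ^ 2) := by
  have hv : ∀ᵐ t : ℝ, t ∈ Icc a b →
      velG (fun t => expLift (s t) (h t)) t = s' t • e 0 + velS h t := by
    filter_upwards [hd, ae_hasDerivAt_velS hh.lipOn] with t h1 h2 hm
    exact velG_expLift (h1 hm) (h2 hm)
  have hl : ∀ᵐ t : ℝ, t ∈ Icc a b →
      lprod (velG (fun t => expLift (s t) (h t)) t) (velG (fun t => expLift (s t) (h t)) t) =
        s' t ^ 2 - speed h t ^ 2 := by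
    filter_upwards [hv, hh.horizontal] with t h1 h2 hm
    rw [h1 hm, lprod_add_self _ (h2 hm).2, speed_sq]
  refine ⟨⟨lipschitzOnIcc_iff.2 (lipOn_mat_expLift hs hh.lipOn), ?_, ?_, ?_⟩, ?_⟩
  · filter_upwards [hv, hh.horizontal] with t h1 h2 hm
    rw [h1 hm, isHermitian_smul_e_zero_add_iff]
    exact (h2 hm).1
  · filter_upwards [hl, hle] with t h1 h2 hm
    rw [h1 hm]
    have := pow_le_pow_left₀ (speed_nonneg h t) (h2 hm) 2
    linarith
  · filter_upwards [hv, hh.horizontal, hpos] with t h1 h2 h3 hm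
    rw [h1 hm, lprod_e0, coord_zero_add _ (h2 hm).2]
    exact h3 hm
  · refine intervalIntegral_congr_ae' hab ?_
    filter_upwards [hl] with t h1 hm
    rw [h1 hm]

/-- The unimodular part of a future directed nonspacelike curve is horizontal, of speed at most
the rate of growth of the logarithm of the determinant. -/
lemma IsFutureNonspacelike.split {f : ℝ → GLp} {a b : ℝ} (hab : a ≤ b)
    (hf : IsFutureNonspacelike f a b) :
    IsHorizontal (fun t => slPart (f t)) a b ∧
    (∀ᵐ t : ℝ, t ∈ Icc a b →
      speed (fun t => slPart (f t)) t ≤ deriv (fun s => logdet (f s)) t) ∧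
    lengthG f a b = ∫ t in a..b, √(deriv (fun s => logdet (f s)) t ^ 2 -
      speed (fun t => slPart (f t)) t ^ 2) := by
  have hv := velG_eq_add hf.lipOn
  have hl : ∀ᵐ t : ℝ, t ∈ Icc a b → lprod (velG f t) (velG f t) =
      deriv (fun s => logdet (f s)) t ^ 2 - speed (fun t => slPart (f t)) t ^ 2 := by
    filter_upwards [hv] with t h1 hm
    rw [(h1 hm).1, lprod_add_self _ (h1 hm).2, speed_sq]
  refine ⟨⟨lipschitzOnIcc_iff.2 (lipOn_slPart hf.lipOn), ?_⟩, ?_, ?_⟩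
  · filter_upwards [hv, hf.horizontal] with t h1 h2 hm
    refine ⟨?_, (h1 hm).2⟩
    have h3 := h2 hm
    rwa [(h1 hm).1, isHermitian_smul_e_zero_add_iff] at h3
  · filter_upwards [hv, hl, hf.nonspacelike, hf.future] with t h1 h2 h3 h4 hm
    have h5 := h4 hm
    rw [(h1 hm).1, lprod_e0, coord_zero_add _ (h1 hm).2] at h5
    have h6 := h3 hm
    rw [h2 hm] at h6
    exact abs_le_of_sq_le_sq' (by linarith) h5.le |>.2
  · refine intervalIntegral_congr_ae' hab ?_
    filter_upwards [hl] with t h1 hm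
    rw [h1 hm]

lemma essBdd_sqrt_sub {σ v : ℝ → ℝ} {a b : ℝ} (hσ : EssBdd σ a b) (hv : EssBdd v a b) :
    EssBdd (fun t => √(σ t ^ 2 - v t ^ 2)) a b :=
  hσ.comp₂ (φ := fun p : ℝ × ℝ => √(p.1 ^ 2 - p.2 ^ 2)) (by fun_prop) hv

lemma integral_deriv_logdet {f : ℝ → GLp} {a b : ℝ} (hab : a ≤ b)
    (hf : LipOn (fun t => mat (f t)) a b) :
    ∫ t in a..b, deriv (fun s => logdet (f s)) t = logdet (f b) - logdet (f a) :=
  (lipOn_logdet hf).integral_eq_sub hab (lipOn_logdet hf).essBdd_deriv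
    (lipOn_logdet hf).ae_hasDerivAt

/-- The reverse Cauchy–Schwarz inequality, integrated along a nonspacelike curve. -/
lemma lengthG_le_of_unit {f : ℝ → GLp} {a b r q : ℝ} (hab : a ≤ b)
    (hf : IsFutureNonspacelike f a b) (hr : 0 < r) (hqr : r ^ 2 - q ^ 2 = 1) :
    lengthG f a b ≤ r * (logdet (f b) - logdet (f a)) -
      q * lengthS (fun t => slPart (f t)) a b := by
  obtain ⟨hh, hle, hlen⟩ := hf.split hab
  have hσ := (lipOn_logdet hf.lipOn).essBdd_deriv
  have hv := essBdd_speed hh.lipOn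
  have hsub : EssBdd (fun t => r * deriv (fun s => logdet (f s)) t -
      q * speed (fun t => slPart (f t)) t) a b :=
    hσ.comp₂ (φ := fun p : ℝ × ℝ => r * p.1 - q * p.2) (by fun_prop) hv
  rw [hlen, ← integral_deriv_logdet hab hf.lipOn, lengthS,
    ← intervalIntegral.integral_const_mul, ← intervalIntegral.integral_const_mul,
    ← intervalIntegral.integral_sub ((hσ.intervalIntegrable hab).const_mul _)
      ((hv.intervalIntegrable hab).const_mul _)]
  refine intervalIntegral_mono_ae hab (essBdd_sqrt_sub hσ hv) hsub ?_
  filter_upwards [hle] with t ht hm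
  have h1 := ht hm
  have h2 := speed_nonneg (fun t => slPart (f t)) t
  set σ := deriv (fun s => logdet (f s)) t
  set v := speed (fun t => slPart (f t)) t
  have hq : |q| ≤ r := abs_le_of_sq_le_sq (by linarith) hr.le
  have hnn : 0 ≤ r * σ - q * v := by
    have h3 : q * v ≤ r * σ :=
      (mul_le_mul_of_nonneg_right ((le_abs_self q).trans hq) h2).trans
        (mul_le_mul_of_nonneg_left h1 hr.le)
    linarith
  refine Real.sqrt_le_iff.2 ⟨hnn, ?_⟩
  have h4 : (r * σ - q * v) ^ 2 - (r ^ 2 - q ^ 2) * (σ ^ 2 - v ^ 2) = (q * σ - r * v) ^ 2 := by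
    ring
  rw [hqr, one_mul] at h4
  nlinarith [sq_nonneg (q * σ - r * v)]

/-- A nonspacelike curve whose unimodular part is as long as the logarithm of the determinant
allows is isotropic. -/
lemma lengthG_nonpos {f : ℝ → GLp} {a b : ℝ} (hab : a ≤ b) (hf : IsFutureNonspacelike f a b)
    (hξ : logdet (f b) - logdet (f a) ≤ lengthS (fun t => slPart (f t)) a b) :
    lengthG f a b ≤ 0 := by
  obtain ⟨hh, hle, hlen⟩ := hf.split hab
  have hσ := (lipOn_logdet hf.lipOn).essBdd_deriv
  have hv := essBdd_speed hh.lipOn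
  set σ := fun t => deriv (fun s => logdet (f s)) t with hσdef
  set v := speed (fun t => slPart (f t)) with hvdef
  have iσ := hσ.intervalIntegrable hab
  have iv := hv.intervalIntegrable hab
  rw [← integral_deriv_logdet hab hf.lipOn] at hξ
  have hξ' : ∫ t in a..b, σ t ≤ ∫ t in a..b, v t := hξ
  rw [hlen]
  -- by the inequality of the means, `2 √(σ² - v²) ≤ K (σ - v) + (σ + v) / K`
  have hbound : ∀ K : ℝ, 0 < K → ∫ t in a..b, √(σ t ^ 2 - v t ^ 2) ≤
      K⁻¹ * ∫ t in a..b, (σ t + v t) := by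
    intro K hK
    have hE : EssBdd (fun t => K * (σ t - v t) + K⁻¹ * (σ t + v t)) a b :=
      hσ.comp₂ (φ := fun p : ℝ × ℝ => K * (p.1 - p.2) + K⁻¹ * (p.1 + p.2)) (by fun_prop) hv
    refine (intervalIntegral_mono_ae hab (essBdd_sqrt_sub hσ hv) hE ?_).trans ?_
    · filter_upwards [hle] with t ht hm
      have h1 : v t ≤ σ t := ht hm
      have h2 : 0 ≤ v t := speed_nonneg _ t
      have h3 : 0 ≤ K * (σ t - v t) := mul_nonneg hK.le (sub_nonneg.2 h1)
      have h4 : 0 ≤ K⁻¹ * (σ t + v t) := mul_nonneg (by positivity) (by linarith)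
      refine Real.sqrt_le_iff.2 ⟨add_nonneg h3 h4, ?_⟩
      have h5 : σ t ^ 2 - v t ^ 2 = (K * (σ t - v t)) * (K⁻¹ * (σ t + v t)) := by
        field_simp
        ring
      rw [h5]
      nlinarith [mul_nonneg h3 h4]
    · rw [intervalIntegral.integral_add ((iσ.sub iv).const_mul _) ((iσ.add iv).const_mul _),
        intervalIntegral.integral_const_mul, intervalIntegral.integral_const_mul,
        intervalIntegral.integral_sub iσ iv]
      have : K * ((∫ t in a..b, σ t) - ∫ t in a..b, v t) ≤ 0 :=
        mul_nonpos_of_nonneg_of_nonpos hK.le (by linarith)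
      linarith
  have hlim : Filter.Tendsto (fun K : ℝ => K⁻¹ * ∫ t in a..b, (σ t + v t)) Filter.atTop
      (nhds 0) := by
    simpa using tendsto_inv_atTop_zero.mul_const (∫ t in a..b, (σ t + v t))
  exact ge_of_tendsto hlim ((Filter.eventually_gt_atTop 0).mono fun K hK => hbound K hK)

/-! ### Longest arcs -/

lemma velG_add_const (g : ℝ → GLp) (β t : ℝ) :
    velG (fun s => g (s + β)) t = velG g (t + β) := by
  simp only [velG, velocity]
  congr 1
  ext i j
  exact deriv_comp_add_const (f := fun s => mat (g s) i j) β t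

lemma IsFutureNonspacelike.add_const {g : ℝ → GLp} {a b : ℝ} (β : ℝ)
    (h : IsFutureNonspacelike g (a + β) (b + β)) :
    IsFutureNonspacelike (fun t => g (t + β)) a b := by
  have hm : ∀ t ∈ Icc a b, t + β ∈ Icc (a + β) (b + β) := fun t ht =>
    ⟨by linarith [ht.1], by linarith [ht.2]⟩
  have hae : ∀ p : ℝ → Prop, (∀ᵐ t : ℝ, p t) → ∀ᵐ t : ℝ, p (t + β) := fun p hp => by
    simpa using ae_comp_affine one_ne_zero β hp
  refine ⟨?_, ?_, ?_, ?_⟩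
  · refine lipschitzOnIcc_iff.2 ?_
    refine LipOn.comp_lipschitz (f := fun t => mat (g t)) h.lipOn ?_ hm
    exact LipOn.of_hasDerivAt (f' := fun _ => 1)
      (fun t _ => by simpa using (hasDerivAt_id t).add_const β) continuousOn_const
  · filter_upwards [hae _ h.horizontal] with t ht hmt
    rw [velG_add_const]
    exact ht (hm t hmt)
  · filter_upwards [hae _ h.nonspacelike] with t ht hmt
    rw [velG_add_const]
    exact ht (hm t hmt)
  · filter_upwards [hae _ h.future] with t ht hmt
    rw [velG_add_const]
    exact ht (hm t hmt)

lemma lengthG_add_const (g : ℝ → GLp) (a b β : ℝ) :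
    lengthG (fun t => g (t + β)) a b = lengthG g (a + β) (b + β) := by
  simp only [lengthG, velG_add_const]
  exact intervalIntegral.integral_comp_add_right
    (fun t => √(lprod (velG g t) (velG g t))) β

lemma isLongestArc_of_forall_le {g : ℝ → GLp} {a b : ℝ} (hab : a < b)
    (h : IsFutureNonspacelike g a b)
    (hmax : ∀ (f : ℝ → GLp) (T : ℝ), 0 < T → IsFutureNonspacelike f 0 T → f 0 = g a →
      f T = g b → lengthG f 0 T ≤ lengthG g a b) : IsLongestArc g a b := by
  refine ⟨hab, h, le_antisymm ?_ (sSup_le ?_)⟩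
  · have h' : IsFutureNonspacelike g (0 + a) (b - a + a) := by simpa using h
    refine le_sSup ⟨_, b - a, sub_pos.2 hab, h'.add_const a, by simp, by simp, ?_⟩
    rw [lengthG_add_const]
    simp
  · rintro L ⟨f, T, hT, hf, h0, h1, rfl⟩
    exact_mod_cast hmax f T hT hf h0 h1

lemma IsLongestArc.le {g : ℝ → GLp} {a b : ℝ} (h : IsLongestArc g a b) {f : ℝ → GLp} {T : ℝ}
    (hT : 0 < T) (hf : IsFutureNonspacelike f 0 T) (h0 : f 0 = g a) (h1 : f T = g b) :
    lengthG f 0 T ≤ lengthG g a b := by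
  have h2 : (lengthG f 0 T : EReal) ≤ (lengthG g a b : EReal) := by
    rw [h.2.2]
    exact le_sSup ⟨f, T, hT, hf, h0, h1, rfl⟩
  exact_mod_cast h2

/-- A horizontal curve shorter than `η ≤ ξ` lifts to a future directed nonspacelike curve along
which the logarithm of the determinant grows by `ξ` and which is longer than `√(ξ² - η²)`. -/
lemma exists_lift_lengthG_gt {h : ℝ → SL2C} {T ξ η : ℝ} (α : ℝ) (hT : 0 < T)
    (hh : IsHorizontal h 0 T) (hlt : lengthS h 0 T < η) (hηξ : η ≤ ξ) :
    ∃ f : ℝ → GLp, IsFutureNonspacelike f 0 T ∧ f 0 = expLift α (h 0) ∧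
      f T = expLift (α + ξ) (h T) ∧ √(ξ ^ 2 - η ^ 2) < lengthG f 0 T := by
  set ℓ := lengthS h 0 T with hℓ
  have hℓ0 : 0 ≤ ℓ := intervalIntegral.integral_nonneg hT.le fun t _ => speed_nonneg h t
  set δ := (η - ℓ) / (2 * T) with hδ
  have hδ0 : 0 < δ := div_pos (sub_pos.2 hlt) (by positivity)
  have hvE := essBdd_speed hh.lipOn
  set s : ℝ → ℝ := fun t => speed h t + δ with hs
  have hs0 : ∀ t, 0 < s t := fun t => add_pos_of_nonneg_of_pos (speed_nonneg h t) hδ0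
  have hvs : ∀ t, speed h t ≤ s t := fun t => le_add_of_nonneg_right hδ0.le
  have hsE : EssBdd s 0 T := hvE.comp (φ := fun x => x + δ) (by fun_prop)
  obtain ⟨ℓ', hℓ'⟩ : ∃ ℓ', ℓ' = (η + ℓ) / 2 := ⟨_, rfl⟩
  have hsint : ∫ t in 0..T, s t = ℓ' := by
    rw [hs, intervalIntegral.integral_add (hvE.intervalIntegrable hT.le)
      intervalIntegrable_const]
    change ℓ + _ = ℓ'
    rw [intervalIntegral.integral_const, hδ, hℓ', sub_zero, smul_eq_mul]
    field_simp
    ring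
  have hℓ'0 : 0 < ℓ' := by rw [hℓ']; linarith
  have hℓ'η : ℓ' < η := by rw [hℓ']; linarith
  -- the rate at which the curve has to be lifted to reach the prescribed determinant
  obtain ⟨κ, hκ⟩ : ∃ κ, κ = ξ / ℓ' := ⟨_, rfl⟩
  have hκℓ : κ * ℓ' = ξ := by rw [hκ]; exact div_mul_cancel₀ _ hℓ'0.ne'
  have hκ1 : 1 ≤ κ := by
    rw [hκ, le_div_iff₀ hℓ'0]
    linarith
  have hκ2 : 0 ≤ κ ^ 2 - 1 := by nlinarith
  have hκs : EssBdd (fun t => κ * s t) 0 T := hsE.comp (φ := fun x => κ * x) (by fun_prop)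
  have hSL : LipOn (fun t => α + ∫ x in 0..t, κ * s x) 0 T := by
    obtain ⟨C, -, hC⟩ := (hκs.lipOn_integral hT.le).bound
    refine LipOn.of_bound (C := C) fun x hx y hy => ?_
    rw [add_sub_add_left_eq_sub]
    exact hC x hx y hy
  have hsp : ∀ t, speed h t ≤ κ * s t := fun t =>
    (hvs t).trans (le_mul_of_one_le_left (hs0 t).le hκ1)
  obtain ⟨hfF, hfl⟩ := isFutureNonspacelike_expLift (s' := fun t => κ * s t) hT.le hh hSL
    (by
      filter_upwards [hκs.ae_hasDerivAt_integral hT.le] with t ht hm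
      exact (ht hm).const_add α)
    (Filter.Eventually.of_forall fun t _ => hsp t)
    (Filter.Eventually.of_forall fun t _ => mul_pos (one_pos.trans_le hκ1) (hs0 t))
  refine ⟨_, hfF, ?_, ?_, ?_⟩
  · rw [intervalIntegral.integral_same, add_zero]
  · rw [intervalIntegral.integral_const_mul, hsint, hκℓ]
  have hlow : √(κ ^ 2 - 1) * ℓ' ≤ ∫ t in 0..T, √((κ * s t) ^ 2 - speed h t ^ 2) := by
    rw [← hsint, ← intervalIntegral.integral_const_mul]
    refine intervalIntegral_mono_ae hT.le
      (hsE.comp (φ := fun x => √(κ ^ 2 - 1) * x) (by fun_prop)) (essBdd_sqrt_sub hκs hvE)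
      (Filter.Eventually.of_forall fun t _ => ?_)
    refine Real.le_sqrt_of_sq_le ?_
    rw [mul_pow, Real.sq_sqrt hκ2, mul_pow]
    have h3 := pow_le_pow_left₀ (speed_nonneg h t) (hvs t) 2
    linarith
  rw [hfl]
  refine lt_of_lt_of_le ?_ hlow
  rw [Real.sqrt_lt' (mul_pos (Real.sqrt_pos.2 ?_) hℓ'0), mul_pow, Real.sq_sqrt hκ2, sub_mul,
    ← mul_pow, hκℓ]
  · have h5 : ℓ' ^ 2 < η ^ 2 := pow_lt_pow_left₀ hℓ'η hℓ'0.le two_ne_zero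
    linarith
  · have : 1 < κ := by
      rw [hκ, lt_div_iff₀ hℓ'0]
      linarith
    nlinarith

/-- A lift of uniform rate `r` of a curve of constant speed `q`, with `r² - q² = 1` or
`r = q`, is a longest arc exactly over the segments over which the curve is a shortest arc. -/
theorem isLongestArc_expLift_iff {c : ℝ → SL2C} {r q a b : ℝ} (hab : a < b)
    (hc : IsHorizontal c a b) (hq : ∀ t, speed c t = q) (hr : 0 < r) (hq0 : 0 ≤ q)
    (hrq : r ^ 2 - q ^ 2 = 1 ∨ r = q) :
    IsLongestArc (fun t => expLift (r * t) (c t)) a b ↔ IsShortestArc c a b := by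
  have hqr : q ≤ r := by
    rcases hrq with h | h
    · exact abs_le_of_sq_le_sq' (by linarith) hr.le |>.2
    · exact h.ge
  have hT0 : 0 < b - a := sub_pos.2 hab
  have hlS : lengthS c a b = q * (b - a) := by
    simp only [lengthS, hq, intervalIntegral.integral_const, smul_eq_mul]
    ring
  have hsL : LipOn (fun t : ℝ => r * t) a b :=
    LipOn.of_hasDerivAt (f' := fun _ => r)
      (fun t _ => by simpa using (hasDerivAt_id t).const_mul r) continuousOn_const
  obtain ⟨hF, hlG⟩ := isFutureNonspacelike_expLift (s' := fun _ => r) hab.le hc hsL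
    (Filter.Eventually.of_forall fun t _ => by simpa using (hasDerivAt_id t).const_mul r)
    (Filter.Eventually.of_forall fun t _ => by rw [hq]; exact hqr)
    (Filter.Eventually.of_forall fun t _ => hr)
  simp only [hq, intervalIntegral.integral_const, smul_eq_mul] at hlG
  constructor
  · intro hlong
    refine isShortestArc_of_forall_le hab hc fun h T hT hh h0 h1 => ?_
    by_contra hlt
    rw [not_le, hlS] at hlt
    obtain ⟨f, hf, hf0, hf1, hlen⟩ := exists_lift_lengthG_gt (r * a) hT hh hlt
      (mul_le_mul_of_nonneg_right hqr hT0.le)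
    have hle := hlong.le hT hf (by rw [hf0, h0]) (by rw [hf1, h1]; congr 1; ring)
    rw [hlG] at hle
    refine absurd (hlen.trans_le hle) (not_lt.2 (le_of_eq ?_))
    rw [mul_pow, mul_pow, ← sub_mul, Real.sqrt_mul (by nlinarith [mul_self_le_mul_self hq0 hqr]),
      Real.sqrt_sq hT0.le, mul_comm]
  · intro hshort
    refine isLongestArc_of_forall_le hab hF fun f T hT hf h0 h1 => ?_
    obtain ⟨hh, -, -⟩ := hf.split hT.le
    have hle := hshort.le hT hh (by simp [h0, slPart_expLift]) (by simp [h1, slPart_expLift])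
    have hξ : logdet (f T) - logdet (f 0) = r * (b - a) := by
      rw [h0, h1, logdet_expLift, logdet_expLift]
      ring
    rw [hlS] at hle
    rw [hlG]
    rcases hrq with h | h
    · have h2 := lengthG_le_of_unit hT.le hf hr h
      rw [hξ] at h2
      rw [h, Real.sqrt_one]
      have h3 := mul_le_mul_of_nonneg_left hle hq0
      nlinarith
    · have h2 := lengthG_nonpos hT.le hf (by rw [hξ, h]; exact hle)
      rw [h]
      simpa using h2

/-! ### The minimum principle -/

lemma lprod_add_left (X X' Y : Mat) : lprod (X + X') Y = lprod X Y + lprod X' Y := by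
  simp only [lprod, coord_add, add_mul, Finset.sum_add_distrib]
  ring

lemma lprod_smul_left (c : ℝ) (X Y : Mat) : lprod (c • X) Y = c * lprod X Y := by
  simp only [lprod, coord_smul, mul_assoc, ← Finset.mul_sum, mul_sub]

lemma lprod_comm (X Y : Mat) : lprod X Y = lprod Y X := by
  simp only [lprod, mul_comm]

lemma lprod_add_right (X Y Y' : Mat) : lprod X (Y + Y') = lprod X Y + lprod X Y' := by
  rw [lprod_comm, lprod_add_left, lprod_comm Y, lprod_comm Y']

lemma lprod_smul_right (c : ℝ) (X Y : Mat) : lprod X (c • Y) = c * lprod X Y := by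
  rw [lprod_comm, lprod_smul_left, lprod_comm]

lemma lprod_add_smul_self (X Y : Mat) (ε : ℝ) :
    lprod (X + ε • Y) (X + ε • Y) = lprod X X + 2 * ε * lprod X Y + ε ^ 2 * lprod Y Y := by
  simp only [lprod_add_left, lprod_add_right, lprod_smul_left, lprod_smul_right, lprod_comm Y X]
  ring

lemma isHermitian_smul {X : Mat} (hX : X.IsHermitian) (c : ℝ) : (c • X).IsHermitian := by
  rw [Matrix.IsHermitian, Matrix.conjTranspose_smul, hX.eq]
  simp

lemma isHermitian_e0 : (e0 : Mat).IsHermitian := by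
  have := isHermitian_smul_e_zero 1
  rwa [one_smul] at this

/-- The Fermat rule for `ε A ≥ M (√(1 + 2 b ε + c ε²) - 1)`, with equality at `ε = 0`. -/
lemma eq_mul_of_eventually_le {A M b c : ℝ}
    (h : ∀ᶠ ε : ℝ in nhds 0, 0 ≤ ε * A - M * (√(1 + 2 * ε * b + ε ^ 2 * c) - 1)) :
    A = M * b := by
  have hmin : IsLocalMin (fun ε : ℝ => ε * A - M * (√(1 + 2 * ε * b + ε ^ 2 * c) - 1)) 0 := by
    filter_upwards [h] with ε hε
    simpa using hε
  have hp : HasDerivAt (fun ε : ℝ => 1 + 2 * ε * b + ε ^ 2 * c) (2 * b) 0 := by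
    have h1 : HasDerivAt (fun ε : ℝ => 1 + 2 * ε * b + ε ^ 2 * c)
        (0 + 2 * 1 * b + (2 : ℕ) * (0 : ℝ) ^ (2 - 1) * 1 * c) 0 :=
      ((hasDerivAt_const _ _).add (((hasDerivAt_id _).const_mul 2).mul_const b)).add
        (((hasDerivAt_id (0 : ℝ)).pow 2).mul_const c)
    simpa using h1
  have hs := hp.sqrt (by norm_num)
  have hd := ((hasDerivAt_id (0 : ℝ)).mul_const A).sub ((hs.sub_const 1).const_mul M)
  have h0 := hmin.hasDerivAt_eq_zero hd
  simp at h0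
  linarith

/-- At a minimum over the hyperboloid `⟨u, u⟩ = 1` a functional is a multiple of the product with
the minimizer. -/
lemma dual_eq_of_isLeast_U {ψ : Module.Dual ℝ gl2p} {u : gl2p} {M : ℝ}
    (hu : (u : Mat).IsHermitian) (hu1 : lprod (u : Mat) (u : Mat) = 1)
    (hu0 : 0 < lprod (u : Mat) e0) (hψ : ψ u = M) (hmin : IsLeast (ψ '' U) M) (w : gl2p)
    (hw : (w : Mat).IsHermitian) : ψ w = M * lprod (u : Mat) (w : Mat) := by
  refine eq_mul_of_eventually_le (c := lprod (w : Mat) (w : Mat)) ?_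
  have h1 : ∀ᶠ ε : ℝ in nhds 0,
      0 < 1 + 2 * ε * lprod (u : Mat) (w : Mat) + ε ^ 2 * lprod (w : Mat) (w : Mat) := by
    have hc : Continuous fun ε : ℝ =>
        1 + 2 * ε * lprod (u : Mat) (w : Mat) + ε ^ 2 * lprod (w : Mat) (w : Mat) := by fun_prop
    exact hc.continuousAt.eventually_const_lt (by simp)
  have h2 : ∀ᶠ ε : ℝ in nhds 0, 0 < lprod (u : Mat) e0 + ε * lprod (w : Mat) e0 := by
    have hc : Continuous fun ε : ℝ => lprod (u : Mat) e0 + ε * lprod (w : Mat) e0 := by fun_prop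
    exact hc.continuousAt.eventually_const_lt (by simpa using hu0)
  filter_upwards [h1, h2] with ε hε hε'
  set Q := 1 + 2 * ε * lprod (u : Mat) (w : Mat) + ε ^ 2 * lprod (w : Mat) (w : Mat) with hQ
  have hQs : 0 < √Q := Real.sqrt_pos.2 hε
  have hx : lprod ((u : Mat) + ε • (w : Mat)) ((u : Mat) + ε • (w : Mat)) = Q := by
    rw [lprod_add_smul_self, hu1]
  have hmem : (√Q)⁻¹ • (u + ε • w) ∈ U := by
    refine ⟨isHermitian_smul (hu.add (isHermitian_smul hw ε)) _, ?_, ?_⟩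
    · change 1 ≤ lprod ((√Q)⁻¹ • ((u : Mat) + ε • (w : Mat)))
        ((√Q)⁻¹ • ((u : Mat) + ε • (w : Mat)))
      rw [lprod_smul_left, lprod_smul_right, hx, ← mul_assoc, ← mul_inv,
        Real.mul_self_sqrt hε.le, inv_mul_cancel₀ hε.ne']
    · change 0 < lprod ((√Q)⁻¹ • ((u : Mat) + ε • (w : Mat))) e0
      rw [lprod_smul_left, lprod_add_left, lprod_smul_left]
      positivity
  have hle := hmin.2 ⟨_, hmem, rfl⟩
  rw [map_smul, map_add, map_smul, hψ, smul_eq_mul, smul_eq_mul, le_inv_mul_iff₀ hQs] at hle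
  linarith

/-- The same representation for isotropic controls `u`, from the minimum at `u - e₀` over the unit
sphere of `H₀` and the value at `e₀`. -/
lemma dual_eq_of_isLeast_W {ψ : Module.Dual ℝ gl2p} {u : gl2p} {M : ℝ}
    (hu : (u : Mat).IsHermitian) (hu1 : lprod (u : Mat) (u : Mat) = 0)
    (hu0 : lprod (u : Mat) e0 = 1) (hψ0 : ψ e0 = M) (hψ : ψ (u - e0) = -M)
    (hmin : IsLeast (ψ '' W) (-M)) (w : gl2p)
    (hw : (w : Mat).IsHermitian) : ψ w = M * lprod (u : Mat) (w : Mat) := by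
  have he := isHermitian_e0
  have he1 : lprod (e0 : Mat) (e0 : Mat) = 1 := by
    rw [lprod_e0]
    change coord 0 (e 0) = 1
    have := coord_zero_add (w := 0) 1 (by simp)
    simpa using this
  -- the assertion for `w` orthogonal to `e₀`
  have key : ∀ w : gl2p, (w : Mat).IsHermitian → lprod (w : Mat) e0 = 0 →
      ψ w = M * lprod (u : Mat) (w : Mat) := by
    intro w hw hw0
    set x : gl2p := u - e0 with hx
    have hxc : (x : Mat) = (u : Mat) + (-1 : ℝ) • (e0 : Mat) := by
      rw [hx, neg_one_smul, ← sub_eq_add_neg]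
      rfl
    have hxH : (x : Mat).IsHermitian := by
      rw [hxc]
      exact hu.add (isHermitian_smul he _)
    have hx0 : lprod (x : Mat) e0 = 0 := by
      rw [hxc, lprod_add_left, lprod_smul_left, hu0, he1]
      ring
    have hx1 : lprod (x : Mat) (x : Mat) = -1 := by
      rw [hxc, lprod_add_smul_self, hu1, hu0, he1]
      ring
    have hxw : lprod (x : Mat) (w : Mat) = lprod (u : Mat) (w : Mat) := by
      rw [hxc, lprod_add_left, lprod_smul_left, lprod_comm (e0 : Mat), hw0]
      ring
    have hfin : ψ w = (-M) * (-lprod (x : Mat) (w : Mat)) := by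
      refine eq_mul_of_eventually_le (c := -lprod (w : Mat) (w : Mat)) ?_
      have h1 : ∀ᶠ ε : ℝ in nhds 0, 0 < 1 + 2 * ε * (-lprod (x : Mat) (w : Mat)) +
          ε ^ 2 * (-lprod (w : Mat) (w : Mat)) := by
        have hc : Continuous fun ε : ℝ => 1 + 2 * ε * (-lprod (x : Mat) (w : Mat)) +
          ε ^ 2 * (-lprod (w : Mat) (w : Mat)) := by fun_prop
        exact hc.continuousAt.eventually_const_lt (by simp)
      filter_upwards [h1] with ε hε
      set Q := 1 + 2 * ε * (-lprod (x : Mat) (w : Mat)) +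
          ε ^ 2 * (-lprod (w : Mat) (w : Mat)) with hQ
      have hQs : 0 < √Q := Real.sqrt_pos.2 hε
      have hxx : lprod ((x : Mat) + ε • (w : Mat)) ((x : Mat) + ε • (w : Mat)) = -Q := by
        rw [lprod_add_smul_self, hx1, hQ]
        ring
      have hmem : (√Q)⁻¹ • (x + ε • w) ∈ W := by
        refine ⟨isHermitian_smul (hxH.add (isHermitian_smul hw ε)) _, ?_, ?_⟩
        · change lprod ((√Q)⁻¹ • ((x : Mat) + ε • (w : Mat))) e0 = 0
          rw [lprod_smul_left, lprod_add_left, lprod_smul_left, hx0, hw0]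
          ring
        · change lprod ((√Q)⁻¹ • ((x : Mat) + ε • (w : Mat)))
            ((√Q)⁻¹ • ((x : Mat) + ε • (w : Mat))) = -1
          rw [lprod_smul_left, lprod_smul_right, hxx, ← mul_assoc, ← mul_inv,
            Real.mul_self_sqrt hε.le, mul_neg, inv_mul_cancel₀ hε.ne']
      have hle := hmin.2 ⟨_, hmem, rfl⟩
      rw [map_smul, map_add, map_smul, hψ, smul_eq_mul, smul_eq_mul, le_inv_mul_iff₀ hQs] at hle
      linarith
    rw [hfin, hxw]
    ring
  set c := lprod (w : Mat) e0 with hc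
  have hw' : ((w + (-c) • e0 : gl2p) : Mat) = (w : Mat) + (-c) • (e0 : Mat) := rfl
  have h1 := key (w + (-c) • e0) (by rw [hw']; exact hw.add (isHermitian_smul he _)) (by
    rw [hw', lprod_add_left, lprod_smul_left, he1, ← hc]
    ring)
  rw [hw', lprod_add_right, lprod_smul_right, hu0, map_add, map_smul, hψ0, smul_eq_mul] at h1
  linarith

/-- A function that is absolutely continuous on all segments, with derivative zero almost
everywhere, is constant. -/
lemma eq_of_absCont_of_ae_hasDerivAt_zero {f : ℝ → ℝ}
    (hf : ∀ a b, AbsolutelyContinuousOnInterval f a b) (hd : ∀ᵐ t : ℝ, HasDerivAt f 0 t) (t : ℝ) :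
    f t = f 0 := by
  obtain ⟨C, hC⟩ := (hf 0 t).const_of_ae_hasDerivAt_zero
    (by filter_upwards [hd] with x hx _ using hx)
  rw [hC t right_mem_uIcc, hC 0 left_mem_uIcc]

lemma lie_e0 (u : gl2p) : ⁅u, e0⁆ = 0 := by
  refine Subtype.ext ?_
  change ⁅(u : Mat), e 0⁆ = 0
  have h : e 0 = (1 / 2 : ℝ) • (1 : Mat) := by
    have := smul_e_zero 1
    rwa [one_smul] at this
  rw [Ring.lie_def, h]
  simp

/-- The minimum principle of either kind says that the covector function of an extremal is,
on Hermitian matrices, a multiple of the product with the control; the control then has constant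
time and space components. -/
lemma exists_control_data {g : ℝ → GLp}
    (hg : IsNormalTimelikeExtremal g ∨ IsNormalIsotropicExtremal g) :
    ∃ (u : ℝ → gl2p) (ψ : ℝ → Module.Dual ℝ gl2p) (M r q : ℝ), IsConjugatePair g u ψ ∧ 0 < M ∧
      0 < r ∧ 0 ≤ q ∧ (r ^ 2 - q ^ 2 = 1 ∨ r = 1 ∧ q = 1) ∧
      ∀ᵐ t : ℝ, (u t : Mat).IsHermitian ∧ coord 0 (u t : Mat) = r ∧
        sprod (u t : Mat) (u t : Mat) = q ^ 2 ∧
        ∀ w : gl2p, (w : Mat).IsHermitian → ψ t w = M * lprod (u t : Mat) (w : Mat) := by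
  have he := isHermitian_e0
  rcases hg with ⟨u, ψ, M, hconj, hM, hmin⟩ | ⟨u, ψ, M, hconj, hM, hψ0, hmin⟩
  · have hconst : ∀ t, ψ t e0 = ψ 0 e0 :=
      eq_of_absCont_of_ae_hasDerivAt_zero (f := fun t => ψ t e0) (hconj.absCont e0) (by
        filter_upwards [hconj.conjugate e0] with t ht
        rw [lie_e0, map_zero] at ht
        exact ht)
    have hall : ∀ᵐ t : ℝ, (u t : Mat).IsHermitian ∧ coord 0 (u t : Mat) = ψ 0 e0 / M ∧
        0 < ψ 0 e0 / M ∧ sprod (u t : Mat) (u t : Mat) = (ψ 0 e0 / M) ^ 2 - 1 ∧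
        ∀ w : gl2p, (w : Mat).IsHermitian → ψ t w = M * lprod (u t : Mat) (w : Mat) := by
      filter_upwards [hmin] with t ⟨h1, h2, h3, h4, h5⟩
      have h6 := dual_eq_of_isLeast_U h1 h2 h3 h4 h5
      have h7 : coord 0 (u t : Mat) = ψ 0 e0 / M := by
        have h8 := h6 e0 he
        rw [hconst, lprod_e0] at h8
        rw [eq_div_iff hM.ne', h8, mul_comm]
      rw [lprod_e0, h7] at h3
      rw [lprod_self, h7] at h2
      exact ⟨h1, h7, h3, by linarith, h6⟩
    obtain ⟨t₀, ht₀⟩ := hall.exists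
    have hq : 0 ≤ (ψ 0 e0 / M) ^ 2 - 1 := ht₀.2.2.2.1 ▸ sprod_self_nonneg _
    refine ⟨u, ψ, M, ψ 0 e0 / M, √((ψ 0 e0 / M) ^ 2 - 1), hconj, hM, ht₀.2.2.1,
      Real.sqrt_nonneg _, Or.inl ?_, ?_⟩
    · rw [Real.sq_sqrt hq]
      ring
    · filter_upwards [hall] with t ht
      rw [Real.sq_sqrt hq]
      exact ⟨ht.1, ht.2.1, ht.2.2.2.1, ht.2.2.2.2⟩
  · refine ⟨u, ψ, M, 1, 1, hconj, hM, one_pos, zero_le_one, Or.inr ⟨rfl, rfl⟩, ?_⟩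
    filter_upwards [hmin] with t ⟨h1, h2, h3, h4, h5⟩
    refine ⟨h1, ?_, ?_, dual_eq_of_isLeast_W h1 h2 h3 (hψ0 t) h4 h5⟩
    · rwa [lprod_e0] at h3
    · rw [lprod_e0] at h3
      rw [lprod_self, h3] at h2
      linarith

/-! ### Normal extremals are smooth -/

/-- The basis `e` as a family of elements of the Lie algebra. -/
def eG (k : Fin 7) : gl2p := ⟨e k, by
  change (e k).trace.im = 0
  fin_cases k <;> simp [e, Matrix.trace_fin_two]⟩

lemma sum_coord_smul_e {X : Mat} (hX : X.trace.im = 0) : ∑ k, coord k X • e k = X := by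
  rw [Matrix.trace_fin_two, Complex.add_im] at hX
  have h0 : coord 0 X = (X 0 0).re + (X 1 1).re := by
    rw [coord_zero, Matrix.trace_fin_two, Complex.add_re]
  have hs : ∑ k, coord k X • e k = coord 0 X • e 0 + coord 1 X • e 1 + coord 2 X • e 2 +
      coord 3 X • e 3 + coord 4 X • e 4 + coord 5 X • e 5 + coord 6 X • e 6 :=
    Fin.sum_univ_seven _
  rw [hs, h0, coord_one, coord_two, coord_three, coord_four, coord_five, coord_six]
  ext i j
  fin_cases i <;> fin_cases j <;> apply Complex.ext <;>
    simp [e] <;> linarith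

lemma dual_eq_sum (ψ : Module.Dual ℝ gl2p) (x : gl2p) :
    ψ x = ∑ k, coord k (x : Mat) * ψ (eG k) := by
  have hx : ∑ k, coord k (x : Mat) • eG k = x := by
    refine Subtype.ext ?_
    have h1 : ((∑ k, coord k (x : Mat) • eG k : gl2p) : Mat) =
        ∑ k, ((coord k (x : Mat) • eG k : gl2p) : Mat) :=
      AddSubmonoidClass.coe_finsetSum _ _
    rw [h1]
    exact sum_coord_smul_e x.2
  conv_lhs => rw [← hx]
  simp only [map_sum, map_smul, smul_eq_mul]

lemma isH0_e (k : Fin 3) : IsH0 (e (k.castLE (by norm_num) : Fin 6).succ) := by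
  have h1 : IsH0 (e 1) := ⟨by
    ext i j
    fin_cases i <;> fin_cases j <;> simp [e], by simp [e, Matrix.trace_fin_two]⟩
  have h2 : IsH0 (e 2) := ⟨by
    ext i j
    fin_cases i <;> fin_cases j <;> simp [e], by simp [e, Matrix.trace_fin_two]⟩
  have h3 : IsH0 (e 3) := ⟨by
    ext i j
    fin_cases i <;> fin_cases j <;> simp [e], by simp [e, Matrix.trace_fin_two]⟩
  fin_cases k
  · exact h1
  · exact h2
  · exact h3

lemma IsH0.coord_eq_zero {X : Mat} (h : IsH0 X) :
    coord 0 X = 0 ∧ coord 4 X = 0 ∧ coord 5 X = 0 ∧ coord 6 X = 0 := by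
  have h10 := h.1.apply 1 0
  have h00 := h.1.apply 0 0
  have h11 := h.1.apply 1 1
  have hr := congrArg Complex.re h10
  have hi := congrArg Complex.im h10
  have hi0 := congrArg Complex.im h00
  have hi1 := congrArg Complex.im h11
  simp only [RCLike.star_def, Complex.conj_re, Complex.conj_im] at hr hi hi0 hi1
  refine ⟨by rw [coord_zero, h.2]; rfl, ?_, ?_, ?_⟩
  · rw [coord_four]; linarith
  · rw [coord_five]; linarith
  · rw [coord_six]; linarith

lemma IsH0.sprod_eq {X : Mat} (h : IsH0 X) (Y : Mat) :
    sprod X Y = coord 1 X * coord 1 Y + coord 2 X * coord 2 Y + coord 3 X * coord 3 Y := by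
  obtain ⟨-, h4, h5, h6⟩ := h.coord_eq_zero
  have hs : sprod X Y = coord 1 X * coord 1 Y + coord 2 X * coord 2 Y + coord 3 X * coord 3 Y +
      coord 4 X * coord 4 Y + coord 5 X * coord 5 Y + coord 6 X * coord 6 Y :=
    Fin.sum_univ_six _
  rw [hs, h4, h5, h6]
  ring

lemma IsH0.eq_of_sprod {X Y : Mat} (hX : IsH0 X) (hY : IsH0 Y)
    (h : ∀ Z, IsH0 Z → sprod X Z = sprod Y Z) : X = Y := by
  have h1 := h _ (hX.sub hY)
  have h2 := sprod_self_of_trace (hX.sub hY).2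
  rw [sprod_sub_left, h1, sub_self] at h2
  have h3 : ‖X - Y‖ = 0 := by
    have : ‖X - Y‖ ^ 2 = 0 := by linarith
    exact pow_eq_zero_iff two_ne_zero |>.1 this
  exact sub_eq_zero.1 (norm_eq_zero.1 h3)

/-- The element of `H₀` that represents, by the scalar product, the functional on `H₀` with the
values `φ` at `e₁, e₂, e₃`. -/
def rieszH0 (φ : Fin 3 → ℝ) : Mat := φ 0 • e 1 + φ 1 • e 2 + φ 2 • e 3

lemma isH0_rieszH0 (φ : Fin 3 → ℝ) : IsH0 (rieszH0 φ) :=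
  (((isH0_e 0).smul _).add ((isH0_e 1).smul _)).add ((isH0_e 2).smul _)

lemma sprod_rieszH0 (φ : Fin 3 → ℝ) (X : Mat) :
    sprod (rieszH0 φ) X = φ 0 * coord 1 X + φ 1 * coord 2 X + φ 2 * coord 3 X := by
  rw [(isH0_rieszH0 φ).sprod_eq]
  congr 1
  · congr 1
    · congr 1
      rw [coord_one]
      simp [rieszH0, e]
      ring
    · congr 1
      rw [coord_two]
      simp [rieszH0, e]
      ring
  · congr 1
    rw [coord_three]
    simp [rieszH0, e]
    ring

/-- A locally Lipschitz curve with continuous velocity is continuously differentiable. -/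
lemma hasDerivAt_of_ae {E : Type*} [NormedAddCommGroup E] [NormedSpace ℝ E] [CompleteSpace E]
    {f f' : ℝ → E} (hf : ∀ a b, LipOn f a b) (hc : Continuous f')
    (hd : ∀ᵐ t : ℝ, HasDerivAt f (f' t) t) (t : ℝ) : HasDerivAt f (f' t) t := by
  have heq : ∀ x ∈ Ioi (t - 1), f x = f (t - 1) + ∫ s in (t - 1)..x, f' s := by
    intro x hx
    rw [LipOn.integral_eq_sub (hf _ _) (le_of_lt hx)
      (EssBdd.of_continuousOn hc.continuousOn)
      (by filter_upwards [hd] with s hs _ using hs)]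
    abel
  have h1 : HasDerivAt (fun x => f (t - 1) + ∫ s in (t - 1)..x, f' s) (f' t) t :=
    (intervalIntegral.integral_hasDerivAt_right (hc.intervalIntegrable _ _)
      hc.aestronglyMeasurable.stronglyMeasurableAtFilter hc.continuousAt).const_add _
  refine h1.congr_of_eventuallyEq ?_
  filter_upwards [Ioi_mem_nhds (show t - 1 < t by linarith)] with x hx using heq x hx

lemma absCont_sum {ι : Type*} (s : Finset ι) {f : ι → ℝ → ℝ} {a b : ℝ}
    (h : ∀ i, AbsolutelyContinuousOnInterval (f i) a b) :
    AbsolutelyContinuousOnInterval (fun t => ∑ i ∈ s, f i t) a b := by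
  classical
  induction s using Finset.induction_on with
  | empty =>
    simp only [Finset.sum_empty]
    exact LipschitzOnWith.absolutelyContinuousOnInterval
      (LipschitzWith.const (0 : ℝ)).lipschitzOnWith
  | insert i s hi ih =>
    simp only [Finset.sum_insert hi]
    exact (h i).add ih

/-- A solution of the conjugate equation is the coadjoint transport of its initial value. -/
lemma dual_transport {g : ℝ → GLp} {u : ℝ → gl2p} {ψ : ℝ → Module.Dual ℝ gl2p} {r : ℝ}
    (hconj : IsConjugatePair g u ψ) (hL : ∀ a b, LipOn (fun t => (slPart (g t) : Mat)) a b)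
    (hd : ∀ᵐ t : ℝ, HasDerivAt (fun s => (slPart (g s) : Mat))
      (slPart (g t) * velS (fun s => slPart (g s)) t) t)
    (hu : ∀ᵐ t : ℝ, (u t : Mat) = r • e 0 + velS (fun s => slPart (g s)) t)
    (h0 : slPart (g 0) = 1) (w : gl2p) (t : ℝ) (x : gl2p)
    (hx : (x : Mat) = adjL (slPart (g t) : Mat) * w * slPart (g t)) : ψ t x = ψ 0 w := by
  set h : ℝ → SL2C := fun s => slPart (g s) with hh
  set X : ℝ → Mat := fun s => adjL (h s : Mat) * w * (h s : Mat) with hX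
  have htr : ∀ s, (X s).trace.im = 0 := by
    intro s
    simp only [hX]
    rw [Matrix.trace_mul_comm, ← mul_assoc, SL2C.mul_adjL_self, one_mul]
    exact w.2
  have hXL : ∀ a b, LipOn X a b := fun a b =>
    (((hL a b).clm_comp adjL).mul (f := fun s => adjL (h s : Mat)) (g := fun _ => (w : Mat))
      ⟨0, (LipschitzWith.const _).lipschitzOnWith⟩).mul (hL a b)
  have hXd : ∀ᵐ t : ℝ, HasDerivAt X (-⁅(u t : Mat), X t⁆) t := by
    filter_upwards [hd, hu] with t ht hut
    have htrv : adjL (velS h t) = -velS h t := adjL_of_trace (trace_velS ht)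
    have hA : HasDerivAt (fun t => adjL (h t : Mat)) (adjL ((h t : Mat) * velS h t)) t :=
      adjL.hasFDerivAt.comp_hasDerivAt t ht
    have h1 := (hA.mul_const (w : Mat)).mul ht
    convert! h1 using 1
    rw [adjL_mul, htrv, hut, smul_e_zero, Ring.lie_def]
    simp only [hX, add_mul, mul_add, smul_mul_assoc, mul_smul_comm, one_mul, mul_one, neg_mul,
      mul_assoc]
    abel
  set F : ℝ → ℝ := fun s => ∑ k, coord k (X s) * ψ s (eG k) with hF
  have hFac : ∀ a b, AbsolutelyContinuousOnInterval F a b := by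
    intro a b
    refine absCont_sum _ fun k => ?_
    have h1 : AbsolutelyContinuousOnInterval (fun s => coord k (X s)) a b := by
      have hl : ∀ a b, LipOn (fun s => coord k (X s)) a b := fun a b =>
        (hXL a b).clm_comp (coordL k).toContinuousLinearMap
      rcases le_total a b with hab | hab
      · exact (hl a b).absCont hab
      · exact ((hl b a).absCont hab).symm
    exact h1.mul (hconj.absCont (eG k) a b)
  have hFd : ∀ᵐ t : ℝ, HasDerivAt F 0 t := by
    have hall : ∀ᵐ t : ℝ, ∀ k, HasDerivAt (fun s => ψ s (eG k)) (ψ t ⁅u t, eG k⁆) t :=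
      ae_all_iff.2 fun k => hconj.conjugate (eG k)
    filter_upwards [hXd, hall] with t ht hk
    have hc : ∀ k, HasDerivAt (fun s => coord k (X s)) (coord k (-⁅(u t : Mat), X t⁆)) t :=
      fun k => (coordL k).toContinuousLinearMap.hasFDerivAt.comp_hasDerivAt t ht
    have h1 : HasDerivAt F (∑ k, (coord k (-⁅(u t : Mat), X t⁆) * ψ t (eG k) +
        coord k (X t) * ψ t ⁅u t, eG k⁆)) t :=
      HasDerivAt.fun_sum fun k _ => (hc k).mul (hk k)
    convert! h1 using 1
    set Xg : gl2p := ⟨X t, htr t⟩ with hXg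
    have h2 : ψ t (-⁅u t, Xg⁆) = ∑ k, coord k (-⁅(u t : Mat), X t⁆) * ψ t (eG k) :=
      dual_eq_sum (ψ t) (-⁅u t, Xg⁆)
    have h3 : ψ t ⁅u t, Xg⁆ = ∑ k, coord k (X t) * ψ t ⁅u t, eG k⁆ :=
      dual_eq_sum ((ψ t).comp (LieAlgebra.ad ℝ gl2p (u t))) Xg
    rw [Finset.sum_add_distrib, ← h2, ← h3, map_neg, neg_add_cancel]
  have hFt := eq_of_absCont_of_ae_hasDerivAt_zero hFac hFd t
  have hX0 : X 0 = w := by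
    have h0' : h 0 = 1 := h0
    simp only [hX, h0', Matrix.SpecialLinearGroup.coe_one, mul_one]
    rw [adjL_apply, Matrix.adjugate_one, one_mul]
  have e1 : ψ t x = F t := by rw [dual_eq_sum, hx]
  have e2 : ψ 0 w = F 0 := by rw [dual_eq_sum, ← hX0]
  rw [e1, e2, hFt]

/-- A normal extremal is the lift, of uniform rate `r`, of a smooth curve in `SL(2,ℂ)` of constant
speed `q`, whose velocity is represented by a constant covector. -/
lemma exists_smooth_data {g : ℝ → GLp}
    (hg : IsNormalTimelikeExtremal g ∨ IsNormalIsotropicExtremal g) (h0 : g 0 = 1) :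
    ∃ (h : ℝ → SL2C) (V : ℝ → Mat) (lam : Mat →ₗ[ℝ] ℝ) (r q : ℝ), h 0 = 1 ∧
      (∀ t, g t = expLift (r * t) (h t)) ∧
      0 < r ∧ 0 ≤ q ∧ (r ^ 2 - q ^ 2 = 1 ∨ r = 1 ∧ q = 1) ∧ Continuous V ∧
      (∀ t, HasDerivAt (fun s => (h s : Mat)) (h t * V t) t) ∧ (∀ t, IsH0 (V t)) ∧
      (∀ t, sprod (V t) (V t) = q ^ 2) ∧
      ∀ t w, IsH0 w → lam (h t * w * adjL (h t)) = sprod (V t) w := by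
  obtain ⟨u, ψ, M, r, q, hconj, hM, hr, hq, hrq, hae⟩ := exists_control_data hg
  have hmL : ∀ a b, LipOn (fun t => mat (g t)) a b := fun a b =>
    lipschitzOnIcc_iff.1 (hconj.lipschitz a b)
  have hglob : ∀ p : ℝ → Prop, (∀ a b, ∀ᵐ t : ℝ, t ∈ Icc a b → p t) → ∀ᵐ t : ℝ, p t := by
    intro p hp
    have h1 : ∀ᵐ t : ℝ, ∀ n : ℕ, t ∈ Icc (-(n : ℝ)) n → p t :=
      ae_all_iff.2 fun n => hp _ _
    filter_upwards [h1] with t ht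
    obtain ⟨n, hn⟩ := exists_nat_ge |t|
    exact ht n (abs_le.1 hn)
  have hgl1 : g 0 = expLift 0 1 := by rw [h0, expLift_zero_one]
  have hs0 : logdet (g 0) = 0 := by rw [hgl1, logdet_expLift]
  have hh0 : slPart (g 0) = 1 := by rw [hgl1, slPart_expLift]
  set h : ℝ → SL2C := fun t => slPart (g t) with hh
  have hL : ∀ a b, LipOn (fun t => (h t : Mat)) a b := fun a b => lipOn_slPart (hmL a b)
  have hd : ∀ᵐ t : ℝ, HasDerivAt (fun s => (h s : Mat)) (h t * velS h t) t :=
    hglob _ fun a b => ae_hasDerivAt_velS (hL a b)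
  have hsplit : ∀ᵐ t : ℝ, velG g t = deriv (fun s => logdet (g s)) t • e 0 + velS h t ∧
      (velS h t).trace = 0 := hglob _ fun a b => velG_eq_add (hmL a b)
  have hsd : ∀ᵐ t : ℝ, HasDerivAt (fun s => logdet (g s)) r t := by
    have h1 : ∀ᵐ t : ℝ, HasDerivAt (fun s => logdet (g s)) (deriv (fun s => logdet (g s)) t) t :=
      hglob _ fun a b => (lipOn_logdet (hmL a b)).ae_hasDerivAt
    filter_upwards [h1, hsplit, hconj.trajectory, hae] with t h1 h2 h3 h4
    have h5 := h4.2.1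
    rw [← h3, h2.1, coord_zero_add _ h2.2] at h5
    rwa [h5] at h1
  have hst : ∀ t, logdet (g t) = r * t := by
    have hE := hasDerivAt_of_ae (f := fun s => logdet (g s)) (f' := fun _ => r)
      (fun a b => lipOn_logdet (hmL a b)) continuous_const hsd
    intro t
    have hz : ∀ t, HasDerivAt (fun s => logdet (g s) - r * s) 0 t := fun t => by
      have h1 : HasDerivAt (fun s => logdet (g s) - r * s) (r - r * 1) t :=
        (hE t).sub ((hasDerivAt_id t).const_mul r)
      simpa using h1
    have := is_const_of_deriv_eq_zero (fun t => (hz t).differentiableAt)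
      (fun t => (hz t).deriv) t 0
    simp only [hs0, mul_zero, sub_zero] at this
    linarith
  have hu : ∀ᵐ t : ℝ, (u t : Mat) = r • e 0 + velS h t := by
    filter_upwards [hsplit, hconj.trajectory, hsd] with t h2 h3 h4
    rw [← h3, h2.1, h4.deriv]
  have hvH : ∀ᵐ t : ℝ, IsH0 (velS h t) := by
    filter_upwards [hsplit, hae, hu] with t h2 h3 h4
    refine ⟨?_, h2.2⟩
    have h5 := h3.1
    rwa [h4, isHermitian_smul_e_zero_add_iff] at h5
  -- the velocity is represented by the covector, and is therefore continuous
  set V : ℝ → Mat := fun t =>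
    rieszH0 fun k => -(ψ t (eG (k.castLE (by norm_num) : Fin 6).succ) / M)
    with hV
  have hVH : ∀ t, IsH0 (V t) := fun t => isH0_rieszH0 _
  have hVψ : ∀ t (w : gl2p), IsH0 (w : Mat) → sprod (V t) w = -(ψ t w / M) := by
    intro t w hw
    obtain ⟨c0, c4, c5, c6⟩ := hw.coord_eq_zero
    have hs : ψ t w = coord 0 (w : Mat) * ψ t (eG 0) + coord 1 (w : Mat) * ψ t (eG 1) +
        coord 2 (w : Mat) * ψ t (eG 2) + coord 3 (w : Mat) * ψ t (eG 3) +
        coord 4 (w : Mat) * ψ t (eG 4) + coord 5 (w : Mat) * ψ t (eG 5) +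
        coord 6 (w : Mat) * ψ t (eG 6) := (dual_eq_sum _ _).trans (Fin.sum_univ_seven _)
    simp only [hV]
    rw [sprod_rieszH0, hs, c0, c4, c5, c6]
    change -(ψ t (eG 1) / M) * _ + -(ψ t (eG 2) / M) * _ + -(ψ t (eG 3) / M) * _ = _
    ring
  have hVc : Continuous V := by
    have hk : ∀ w, Continuous fun t => ψ t w := by
      intro w
      refine continuous_iff_continuousAt.2 fun t => ?_
      refine (hconj.absCont w (t - 1) (t + 1)).continuousOn.continuousAt ?_
      rw [uIcc_of_le (by linarith)]
      exact Icc_mem_nhds (by linarith) (by linarith)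
    simp only [hV, rieszH0]
    have h1 : ∀ k, Continuous fun t => -(ψ t (eG k) / M) := fun k => ((hk _).div_const M).neg
    exact (((h1 _).smul continuous_const).add ((h1 _).smul continuous_const)).add
      ((h1 _).smul continuous_const)
  have hVv : ∀ᵐ t : ℝ, velS h t = V t := by
    filter_upwards [hvH, hae, hu] with t h1 h2 h3
    refine h1.eq_of_sprod (hVH t) fun Z hZ => ?_
    have hZg : Z.trace.im = 0 := by rw [hZ.2]; rfl
    have h4 := hVψ t ⟨Z, hZg⟩ hZ
    have h5 := h2.2.2.2 ⟨Z, hZg⟩ hZ.1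
    have h6 : lprod (u t : Mat) Z = -sprod (velS h t) Z := by
      rw [h3]
      simp only [lprod, hZ.coord_eq_zero.1, coord_succ_add, sprod]
      ring
    change sprod (V t) Z = _ at h4
    rw [h4, h5]
    change _ = -(M * lprod (u t : Mat) Z / M)
    rw [h6]
    field_simp
  have hVd : ∀ t, HasDerivAt (fun s => (h s : Mat)) (h t * V t) t := by
    have hhc : Continuous fun t => (h t : Mat) := by
      refine continuous_iff_continuousAt.2 fun t => ?_
      exact (hL (t - 1) (t + 1)).continuousOn.continuousAt
        (Icc_mem_nhds (by linarith) (by linarith))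
    refine hasDerivAt_of_ae hL (hhc.mul hVc) ?_
    filter_upwards [hd, hVv] with t h1 h2
    rwa [h2] at h1
  have hVq : ∀ t, sprod (V t) (V t) = q ^ 2 := by
    have h1 : (fun t => sprod (V t) (V t)) =ᵐ[volume] fun _ => q ^ 2 := by
      filter_upwards [hVv, hae, hu] with t h2 h3 h4
      have h5 := h3.2.2.1
      rw [h4] at h5
      simp only [sprod, coord_succ_add] at h5
      rw [← h2]
      exact h5
    have h2 := (Continuous.ae_eq_iff_eq volume (continuous_sprod_self.comp hVc)
      continuous_const).1 h1
    exact fun t => congrFun h2 t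
  set lam : Mat →ₗ[ℝ] ℝ := -(M⁻¹ • ∑ k, (ψ 0 (eG k)) • coordL k) with hlam
  have hlamψ : ∀ w : gl2p, lam w = -(ψ 0 w / M) := by
    intro w
    have h1 : lam (w : Mat) = -(M⁻¹ * ∑ k, ψ 0 (eG k) * coord k (w : Mat)) := by
      simp [hlam, coordL]
    rw [h1, dual_eq_sum (ψ 0) w, div_eq_inv_mul]
    simp only [mul_comm (ψ 0 _)]
  refine ⟨h, V, lam, r, q, hh0, fun t => ?_, hr, hq, hrq, hVc, hVd, hVH, hVq, fun t w hw => ?_⟩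
  · rw [← hst t]
    exact (expLift_logdet_slPart _).symm
  · have hw' : w.trace.im = 0 := by rw [hw.2]; rfl
    have hY : ((h t : Mat) * w * adjL (h t : Mat)).trace.im = 0 := by
      rw [Matrix.trace_mul_comm, ← mul_assoc, SL2C.adjL_mul_self, one_mul]
      exact hw'
    have h1 := dual_transport hconj hL hd hu hh0 ⟨_, hY⟩ t ⟨w, hw'⟩ (by
      change w = adjL (h t : Mat) * ((h t : Mat) * w * adjL (h t : Mat)) * (h t : Mat)
      calc w = (adjL (h t : Mat) * (h t : Mat)) * w * (adjL (h t : Mat) * (h t : Mat)) := by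
            rw [SL2C.adjL_mul_self, one_mul, mul_one]
        _ = _ := by simp only [mul_assoc])
    have h2 := hVψ t ⟨w, hw'⟩ hw
    have h3 := hlamψ ⟨_, hY⟩
    change lam ((h t : Mat) * w * adjL (h t : Mat)) = _ at h3
    change sprod (V t) w = _ at h2
    rw [h3, h2, h1]

/-! ### Normal extremals as lifts of unit speed curves -/

lemma velS_one (t : ℝ) : velS (fun _ => 1) t = 0 := by
  refine velS_eq' ?_
  rw [mul_zero]
  exact hasDerivAt_const t ((1 : SL2C) : Mat)

lemma speed_one (t : ℝ) : speed (fun _ => 1) t = 0 := by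
  have h0 : sprod (0 : Mat) 0 = 0 := by simpa using sprod_smul_left 0 0 0
  rw [speed, velS_one, h0, Real.sqrt_zero]

lemma isShortestArc_one {a b : ℝ} (hab : a < b) : IsShortestArc (fun _ => 1) a b := by
  refine isShortestArc_of_forall_le hab
    ⟨⟨0, fun i j => (LipschitzWith.const _).lipschitzOnWith⟩,
      Filter.Eventually.of_forall fun t _ => ?_⟩ fun c T hT _ _ _ => ?_
  · rw [velS_one]
    exact ⟨Matrix.isHermitian_zero, Matrix.trace_zero _ _⟩
  · simp only [lengthS, speed_one, intervalIntegral.integral_zero]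
    exact intervalIntegral.integral_nonneg hT.le fun t _ => speed_nonneg c t

lemma isLongestArc_expLift_one {a b : ℝ} (hab : a < b) :
    IsLongestArc (fun t => expLift t 1) a b := by
  have hs := isShortestArc_one hab
  have := (isLongestArc_expLift_iff (r := 1) hab hs.2.1 speed_one one_pos le_rfl
    (Or.inl (by norm_num))).2 hs
  simpa using this

lemma IsUnitNormal.velS_comp_mul {γ : ℝ → SL2C} {V : ℝ → Mat} {lam : Mat →ₗ[ℝ] ℝ}
    (h : IsUnitNormal γ V lam) (c t : ℝ) :
    SubLorentz.velS (fun t => γ (c * t)) t = c • V (c * t) := by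
  have h2 : HasDerivAt (fun t : ℝ => c * t) c t := by
    simpa using (hasDerivAt_id t).const_mul c
  refine velS_eq' ?_
  convert! HasDerivAt.scomp t (h.hasDerivAt (c * t)) h2 using 1
  rw [mul_smul_comm]

lemma IsUnitNormal.speed_comp_mul {γ : ℝ → SL2C} {V : ℝ → Mat} {lam : Mat →ₗ[ℝ] ℝ}
    (h : IsUnitNormal γ V lam) {c : ℝ} (hc : 0 ≤ c) (t : ℝ) :
    SubLorentz.speed (fun t => γ (c * t)) t = c := by
  rw [SubLorentz.speed, h.velS_comp_mul, sprod_smul_left, sprod_smul_right, h.unit, mul_one,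
    Real.sqrt_mul_self hc]

lemma IsUnitNormal.isHorizontal_comp_mul {γ : ℝ → SL2C} {V : ℝ → Mat} {lam : Mat →ₗ[ℝ] ℝ}
    (h : IsUnitNormal γ V lam) {c : ℝ} (hc : 0 < c) (a b : ℝ) :
    IsHorizontal (fun t => γ (c * t)) a b := by
  simpa using (h.isHorizontal (c * a + 0) (c * b + 0)).affine hc 1

/-- A normal extremal from the unit is either the one-parameter subgroup of `e₀` or the lift of a
normal geodesic of `SL(2,ℂ)`. -/
lemma exists_unitNormal_lift {g : ℝ → GLp}
    (hg : IsNormalTimelikeExtremal g ∨ IsNormalIsotropicExtremal g) (h0 : g 0 = 1) :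
    (∀ t, g t = expLift t 1) ∨
      ∃ (γ : ℝ → SL2C) (V : ℝ → Mat) (lam : Mat →ₗ[ℝ] ℝ) (r q : ℝ), IsUnitNormal γ V lam ∧
        0 < r ∧ 0 < q ∧ (r ^ 2 - q ^ 2 = 1 ∨ r = 1 ∧ q = 1) ∧
        ∀ t, g t = expLift (r * t) (γ (q * t)) := by
  obtain ⟨h, V, lam, r, q, hh0, hgl, hr, hq, hrq, hVc, hVd, hVH, hVq, hlam⟩ :=
    exists_smooth_data hg h0
  rcases hq.eq_or_lt with hq0 | hq0
  · left
    have hr1 : r = 1 := by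
      rcases hrq with h1 | h1
      · nlinarith
      · exact h1.1
    have hV0 : ∀ t, V t = 0 := by
      intro t
      have h1 := sprod_self_of_trace (hVH t).2
      rw [hVq, ← hq0] at h1
      have h2 : ‖V t‖ ^ 2 = 0 := by linarith
      exact norm_eq_zero.1 (pow_eq_zero_iff two_ne_zero |>.1 h2)
    have hz : ∀ t, HasDerivAt (fun s => (h s : Mat)) 0 t := fun t => by
      have h1 := hVd t
      rwa [hV0, mul_zero] at h1
    intro t
    have h1 := is_const_of_deriv_eq_zero (fun t => (hz t).differentiableAt)
      (fun t => (hz t).deriv) t 0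
    have h2 : h t = 1 := by
      rw [← hh0]
      exact Subtype.ext h1
    rw [hgl, h2, hr1, one_mul]
  · right
    have hqq : ∀ t, q⁻¹ * (q * t) = t := fun t => inv_mul_cancel_left₀ hq0.ne' t
    refine ⟨fun s => h (q⁻¹ * s), fun s => q⁻¹ • V (q⁻¹ * s), q⁻¹ • lam, r, q,
      ⟨by fun_prop, fun t => ?_, fun t => (hVH _).smul _, fun t => ?_, fun t w hw => ?_⟩,
      hr, hq0, hrq, fun t => by simp only [hqq, hgl]⟩
    · have h2 : HasDerivAt (fun t : ℝ => q⁻¹ * t) q⁻¹ t := by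
        simpa using (hasDerivAt_id t).const_mul q⁻¹
      convert! HasDerivAt.scomp t (hVd (q⁻¹ * t)) h2 using 1
      rw [mul_smul_comm]
    · rw [sprod_smul_left, sprod_smul_right, hVq]
      field_simp
    · rw [LinearMap.smul_apply, hlam _ _ hw, sprod_smul_left, smul_eq_mul]

end SubLorentz

end

open SubLorentz
theorem mainTheorem4 (g : ℝ → GLp)
    (hg : IsNormalTimelikeExtremal g ∨ IsNormalIsotropicExtremal g) (h0 : g 0 = 1) :
    IsLorentzGeodesic g ∧
    (((∀ t, g t = expLift t 1) ∧ ∀ a b, a < b → IsLongestArc g a b) ∨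
      ∃ (γ : ℝ → SL2C) (r σ : ℝ), 0 < r ∧ 0 < σ ∧
        IsRiemGeodesic γ ∧ (∀ᵐ t : ℝ, speed γ t = σ) ∧
        (∀ a b, a < b → IsFutureNonspacelike (fun t => expLift t (γ t)) a b) ∧
        (∀ t, g t = expLift (r * t) (γ (r * t))) ∧
        ∀ a b, a < b → (IsLongestArc g a b ↔ IsShortestArc γ (r * a) (r * b))) ∧
    (∀ a b, a < b → IsLongestArc g a b →
      (∀ t ∈ Set.Icc 0 (b - a), (g a)⁻¹ * g (a + t) = expLift t 1) ∨
        IsShortestArcLift (fun t => (g a)⁻¹ * g (a + t)) (b - a)) := by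
  rcases exists_unitNormal_lift hg h0 with hg1 | ⟨γ, V, lam, r, q, hγ, hr, hq, hrq, hgl⟩
  · have hlong : ∀ a b, a < b → IsLongestArc g a b := fun a b hab => by
      rw [funext hg1]
      exact isLongestArc_expLift_one hab
    refine ⟨fun t => ⟨1, one_pos, hlong _ _ (by linarith)⟩, Or.inl ⟨hg1, hlong⟩,
      fun a b _ _ => Or.inl fun t _ => ?_⟩
    rw [hg1, hg1, expLift_inv, expLift_mul]
    simp
  have hqr : q ≤ r := by
    rcases hrq with h | ⟨rfl, rfl⟩
    · exact abs_le_of_sq_le_sq' (by linarith) hr.le |>.2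
    · exact le_rfl
  have hiff : ∀ a b, a < b → (IsLongestArc g a b ↔ IsShortestArc γ (q * a) (q * b)) := by
    intro a b hab
    rw [funext hgl, ← isShortestArc_comp_mul_iff hq]
    exact isLongestArc_expLift_iff hab (hγ.isHorizontal_comp_mul hq a b)
      (hγ.speed_comp_mul hq.le) hr hq.le (hrq.imp_right fun h => h.1.trans h.2.symm)
  have hqr0 : 0 < q / r := div_pos hq hr
  have hcancel : ∀ t, q / r * (r * t) = q * t := fun t => by field_simp
  refine ⟨fun t => ?_, Or.inr ⟨fun s => γ (q / r * s), r, q / r, hr, hqr0,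
    hγ.isRiemGeodesic.comp_mul hqr0,
    Filter.Eventually.of_forall (hγ.speed_comp_mul hqr0.le), fun a b hab => ?_, fun t => ?_,
    fun a b hab => ?_⟩, fun a b hab hlong => Or.inr ?_⟩
  · obtain ⟨ε, hε, hs⟩ := hγ.isRiemGeodesic.comp_mul hq t
    refine ⟨ε, hε, (hiff _ _ (by linarith)).2 ?_⟩
    rwa [← isShortestArc_comp_mul_iff hq]
  · refine (isFutureNonspacelike_expLift (s := fun t => t) (s' := fun _ => 1) hab.le
      (hγ.isHorizontal_comp_mul hqr0 a b)
      (LipOn.of_hasDerivAt (fun t _ => hasDerivAt_id t) continuousOn_const)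
      (Filter.Eventually.of_forall fun t _ => hasDerivAt_id t)
      (Filter.Eventually.of_forall fun t _ => ?_)
      (Filter.Eventually.of_forall fun t _ => one_pos)).1
    rw [hγ.speed_comp_mul hqr0.le]
    exact (div_le_one hr).2 hqr
  · simp only [hgl, hcancel]
  · rw [hiff a b hab, ← hcancel a, ← hcancel b, isShortestArc_comp_mul_iff hqr0]
  · have hT : 0 < b - a := sub_pos.2 hab
    have hshort : IsShortestArc γ (1 * 0 + q * a) (1 * (q * (b - a)) + q * a) := by
      have h1 := (hiff a b hab).1 hlong
      convert! h1 using 1 <;> ring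
    have hη : 0 < q * (b - a) := mul_pos hq hT
    -- the segment of the geodesic, moved to the unit
    have hmoved := hshort.affine one_pos (γ (q * a))⁻¹
    have hlen : lengthS (fun s => (γ (q * a))⁻¹ * γ (1 * s + q * a)) 0 (q * (b - a)) =
        q * (b - a) := by
      rw [lengthS_affine one_pos hη.le _ (hγ.isHorizontal _ _).lipOn, hγ.lengthS]
      ring
    have hrho := hmoved.2.2
    rw [hlen] at hrho
    have hk : ∀ t, (g a)⁻¹ * g (a + t) =
        expLift (r * t) ((γ (q * a))⁻¹ * γ (1 * (q * t) + q * a)) := by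
      intro t
      rw [hgl, hgl, expLift_inv, expLift_mul]
      congr 1
      · ring
      · congr 2
        ring
    refine ⟨r * (b - a), q * (b - a), (γ (q * a))⁻¹ * γ (1 * (q * (b - a)) + q * a),
      fun s => (γ (q * a))⁻¹ * γ (1 * s + q * a), hη, mul_le_mul_of_nonneg_right hqr hT.le,
      ?_, hk _, hmoved, ?_, by simp, rfl, ?_⟩
    · rw [hrho]
      simp
    · filter_upwards [velS_affine (β := q * a) one_pos (γ (q * a))⁻¹
        (hγ.isHorizontal (1 * 0 + q * a) (1 * (q * (b - a)) + q * a)).lipOn] with t ht hm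
      rw [speed_affine one_pos (ht hm), hγ.speed, one_mul]
    · rcases hrq with h | ⟨rfl, rfl⟩
      · have hsinh : Real.sinh (Real.arsinh q) = q := Real.sinh_arsinh q
        have hcosh : Real.cosh (Real.arsinh q) = r := by
          rw [Real.cosh_arsinh, ← Real.sqrt_sq hr.le]
          congr 1
          linarith
        refine Or.inl ⟨?_, Real.arsinh q, Real.arsinh_pos_iff.2 hq, ?_, ?_, fun t _ => ?_⟩
        · refine mul_lt_mul_of_pos_right ?_ hT
          nlinarith
        · rw [hcosh, mul_comm]
        · rw [hsinh, mul_comm]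
        · rw [hcosh, hsinh]
          exact hk t
      · refine Or.inr ⟨rfl, (one_mul _).symm, fun t _ => ?_⟩
        have := hk t
        rwa [one_mul t] at this
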